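/- Let $N\ge 1$, $s\in(0,1)$, $\rho>0$, $c_\infty>0$, and let $\Psi$ be the unique positive eigenfunction of $-\Delta$ on $B_\rho(0)\subset\mathbb R^N$ with zero Dirichlet boundary condition corresponding to the first eigenvalue, normalized by $\|\Psi\|_{L^\infty(B_\rho(0))}=1$. Notation. Let $$\mathcal E(u,\varphi)=\frac{c_{N,s}}2\int_{\mathbb R^N}\int_{\mathbb R^N}\frac{(u(x)-u(y))(\varphi(x)-\varphi(y))}{|x-y|^{N+2s}}\,dx\,dy,\qquad c_{N,s}=s(1-s)\pi^{-N/2}4^s\frac{\Gamma(\frac N2+s)}{\Gamma(2-s)},$$ let $\mathcal H^s_0(U)=\{u\in H^s(\mathbb R^N): u=0 \text{ on } \mathbb R^N\setminus U\}$ and, for $U'\subset\mathbb R^N$ open, let $\mathcal V^s(U')$ be the space of all $u\in L^\infty(\mathbb R^N)$ for which $$\|u\|_{\mathcal V^s(U')}=\|u\|_{L^\infty(\mathbb R^N)}+\Bigl(\int_{U'\times U'}\frac{|u(x)-u(y)|^2}{|x-y|^{N+2s}}\,dx\,dy\Bigr)^{1/2}$$ is finite. Let $H\subset\mathbb R^N$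 be an open half space, $Q$ the reflection at $\partial H$, $T$ a time interval, $U\subset H$ a bounded open set and $c\in L^\infty(T\times U)$. An antisymmetric supersolution of $$\partial_t v+(-\Delta)^s v=c(t,x)\,v\quad\text{on } T\times U \tag{1}$$ is a function $v:T\times\mathbb R^N\to\mathbb R$ with $v(t,Q(x))=-v(t,x)$ for all $t\in T$ and $x \in \mathbb R^N$, with $v\in C(T,\mathcal V^s(U'))\cap C^1(T,L^2(U))$ for some open $U'\supset\overline U$, and such that for every $\varphi\in\mathcal H^s_0(U)$ with $\varphi\ge0$ and a.e. $t\in T$ $$\mathcal E(v(t),\varphi)\ \ge\ \int_U\bigl(c(t,x)v(t,x)-\partial_t v(t,x)\bigr)\varphi(x)\,dx .$$ Functions of $x$ are elements of $L^\infty$, $L^2$ or $H^s$, so that antisymmetry and all inequalities between them are understood for a.e. $x$, at each fixed time where a time is given. Proposition. There exist $\gamma=\gamma(N,s,\rho,c_\infty)>0$ and $q=q(N,s,\rho,c_\infty)>0$ with the following property. Let $H$ be an open half space, $T=[t_0,t_1]$ with $t_0<t_1$, let $x_0\in H$ with $\operatorname{dist}(x_0,\partial H)\ge 2\rho$, let $\sigma_0>0$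 and $\sigma_1\ge q\sigma_0$, let $c\in L^\infty(T\times B_\rho(x_0))$ with $\|c\|_{L^\infty(T\times B_\rho(x_0))}\le c_\infty$, and let $v$ be an antisymmetric supersolution of (1) on $T\times B_\rho(x_0)$ such that (i) $v(t)\in H^s(\mathbb R^N)$ for all $t\in T$; (ii) $v(t)\ge0$ on $B_{2\rho}(x_0)$ for all $t\in T$; (iii) $\|v^-(t)\|_{L^\infty(H\setminus B_{2\rho}(x_0))}\le\sigma_0e^{-(\gamma+1)(t-t_0)}$ for all $t\in T$, where $v^-=\max\{-v,0\}$; (iv) $v(t_0,x)\ge\sigma_1\Psi(x-x_0)$ for $x\in B_\rho(x_0)$. Then for every $t\in T$ $$v(t,x)\ \ge\ \sigma_1e^{-\gamma(t-t_0)}\Psi(x-x_0)\qquad\text{for a.e. } x\in B_\rho(x_0),$$ and this holds for every $x\in B_\rho(x_0)$ whenever $v(t)$ is continuous on $B_\rho(x_0)$. -/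

import Mathlib

open MeasureTheory Filter Topology
open scoped ENNReal

namespace FracParabolic

noncomputable section

/-- The Euclidean space `ℝ^N`. -/
abbrev Space (N : ℕ) : Type := EuclideanSpace ℝ (Fin N)

/-! ### Half spaces, reflections, antisymmetry -/

/-- The open half space `{x : ⟨e, x⟩ > b}` (for a unit vector `e`). -/
def halfSpace {N : ℕ} (e : Space N) (b : ℝ) : Set (Space N) := {x | b < inner ℝ e x}

/-- The reflection at the hyperplane `{x : ⟨e, x⟩ = b}` (for a unit vector `e`). -/
def reflect {N : ℕ} (e : Space N) (b : ℝ) (x : Space N) : Space N :=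
  x - (2 * (inner ℝ e x - b)) • e

/-- Antisymmetry with respect to the reflection, for functions defined up to null sets. -/
def Antisymmetric {N : ℕ} (e : Space N) (b : ℝ) (w : Space N → ℝ) : Prop :=
  ∀ᵐ x, w (reflect e b x) = -w x

/-! ### Fractional Sobolev spaces and the quadratic form of the fractional Laplacian -/

/-- The normalization constant `c_{N,s}` of the fractional Laplacian. -/
def fracConst (N : ℕ) (s : ℝ) : ℝ :=
  s * (1 - s) * Real.pi ^ (-(N : ℝ) / 2) * (4 : ℝ) ^ s
    * (Real.Gamma ((N : ℝ) / 2 + s) / Real.Gamma (2 - s))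

/-- `∫_{A × A} |u(x) - u(y)|² / |x - y|^{N + 2s} dx dy`. -/
def gagliardoSq {N : ℕ} (s : ℝ) (A : Set (Space N)) (u : Space N → ℝ) : ℝ≥0∞ :=
  ∫⁻ p in A ×ˢ A, ENNReal.ofReal (|u p.1 - u p.2| ^ 2 / ‖p.1 - p.2‖ ^ ((N : ℝ) + 2 * s))

/-- `u ∈ H^s(ℝ^N)`. -/
def MemHs {N : ℕ} (s : ℝ) (u : Space N → ℝ) : Prop :=
  MemLp u 2 volume ∧ gagliardoSq s Set.univ u < ∞

/-- `u ∈ 𝓗^s_0(U)`: `u ∈ H^s(ℝ^N)` and `u = 0` (a.e.) on `ℝ^N \ U`. -/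
def MemHs0 {N : ℕ} (s : ℝ) (U : Set (Space N)) (u : Space N → ℝ) : Prop :=
  MemHs s u ∧ ∀ᵐ x, x ∉ U → u x = 0

/-- The norm `‖u‖_{L^∞(ℝ^N)} + (∫_{U' × U'} |u(x) - u(y)|² / |x - y|^{N + 2s} dx dy)^{1/2}`,
with value `∞` allowed. -/
def normV {N : ℕ} (s : ℝ) (U' : Set (Space N)) (u : Space N → ℝ) : ℝ≥0∞ :=
  eLpNorm u ∞ volume + gagliardoSq s U' u ^ (1 / 2 : ℝ)

/-- `u ∈ 𝓥^s(U')`. -/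
def MemV {N : ℕ} (s : ℝ) (U' : Set (Space N)) (u : Space N → ℝ) : Prop :=
  AEStronglyMeasurable u volume ∧ normV s U' u < ∞

/-- `v ∈ C(T, 𝓥^s(U'))`. -/
def ContinuousInV {N : ℕ} (s : ℝ) (T : Set ℝ) (U' : Set (Space N)) (v : ℝ → Space N → ℝ) : Prop :=
  (∀ t ∈ T, MemV s U' (v t)) ∧
    ∀ t ∈ T, Tendsto (fun τ => normV s U' (fun x => v τ x - v t x)) (𝓝[T] t) (𝓝 0)

/-- The bilinear form `𝓔(u, φ)` of `(-Δ)^s`. -/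
def energy {N : ℕ} (s : ℝ) (u φ : Space N → ℝ) : ℝ :=
  fracConst N s / 2 *
    ∫ p : Space N × Space N,
      (u p.1 - u p.2) * (φ p.1 - φ p.2) / ‖p.1 - p.2‖ ^ ((N : ℝ) + 2 * s)

/-! ### Supersolutions -/

/-- `v` is a supersolution of `∂_t v + (-Δ)^s v = c(t,x) v` on `T × U`, where `U` is a bounded open
set and `c ∈ L^∞(T × U)`. The curve `V` is `v` seen as an element of `C¹(T, L²(U))`, and
`derivWithin V T t` is `∂_t v(t) ∈ L²(U)`. -/
def IsSupersolution {N : ℕ} (s : ℝ) (T : Set ℝ) (U : Set (Space N)) (c v : ℝ → Space N → ℝ) :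
    Prop :=
  IsOpen U ∧ Bornology.IsBounded U ∧
  MemLp (Function.uncurry c) ∞ (volume.restrict (T ×ˢ U)) ∧
  (∃ U' : Set (Space N), IsOpen U' ∧ closure U ⊆ U' ∧ ContinuousInV s T U' v) ∧
  ∃ V : ℝ → Lp ℝ 2 (volume.restrict U),
    (∀ t ∈ T, V t =ᵐ[volume.restrict U] v t) ∧
    ContDiffOn ℝ 1 V T ∧
    ∀ φ : Space N → ℝ, MemHs0 s U φ → (∀ᵐ x, 0 ≤ φ x) →
      ∀ᵐ t ∂(volume.restrict T),
        energy s (v t) φ ≥ ∫ x in U, (c t x * v t x - derivWithin V T t x) * φ x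

/-- `v` is an antisymmetric supersolution of `∂_t v + (-Δ)^s v = c(t,x) v` on `T × U`, with respect
to the half space `{x : ⟨e, x⟩ > b}`. -/
def IsAntisymmetricSupersolution {N : ℕ} (s : ℝ) (e : Space N) (b : ℝ) (T : Set ℝ)
    (U : Set (Space N)) (c v : ℝ → Space N → ℝ) : Prop :=
  IsSupersolution s T U c v ∧ U ⊆ halfSpace e b ∧ ∀ t ∈ T, Antisymmetric e b (v t)

/-! ### The first Dirichlet eigenfunction of the Laplacian on a ball -/

/-- `u ∈ C²(B_ρ(0)) ∩ C(closure B_ρ(0))` is a nontrivial solution of `-Δu = lam u` in `B_ρ(0)`,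
`u = 0` on `∂B_ρ(0)`. -/
def IsDirichletEigenfunction {N : ℕ} (ρ lam : ℝ) (u : Space N → ℝ) : Prop :=
  ContDiffOn ℝ 2 u (Metric.ball 0 ρ) ∧
  ContinuousOn u (Metric.closedBall 0 ρ) ∧
  (∀ x ∈ Metric.ball (0 : Space N) ρ, -(Laplacian.laplacian u x) = lam * u x) ∧
  (∀ x ∈ Metric.sphere (0 : Space N) ρ, u x = 0) ∧
  ∃ x ∈ Metric.ball (0 : Space N) ρ, u x ≠ 0

/-- `lam` is the first Dirichlet eigenvalue of `-Δ` on `B_ρ(0) ⊆ ℝ^N`. -/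
def IsFirstDirichletEigenvalue (N : ℕ) (ρ lam : ℝ) : Prop :=
  IsLeast {μ : ℝ | ∃ u : Space N → ℝ, IsDirichletEigenfunction ρ μ u} lam

/-- `Ψ` is the positive eigenfunction of `-Δ` on `B_ρ(0)` for the first Dirichlet eigenvalue, with
`‖Ψ‖_{L^∞(B_ρ(0))} = 1`. -/
def IsNormalizedFirstEigenfunction {N : ℕ} (ρ : ℝ) (Ψ : Space N → ℝ) : Prop :=
  (∃ lam : ℝ, IsFirstDirichletEigenvalue N ρ lam ∧ IsDirichletEigenfunction ρ lam Ψ) ∧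
  (∀ x ∈ Metric.ball (0 : Space N) ρ, 0 < Ψ x) ∧
  eLpNorm Ψ ∞ (volume.restrict (Metric.ball (0 : Space N) ρ)) = 1

end

end FracParabolic

open FracParabolic

/-!
Write `B = B_ρ(x₀)`, let `Q` be the reflection, `u` the zero extension of `Ψ(· - x₀)` and
`κ(t) = σ₁ exp(-γ (t - t₀))`. The comparison function is `κ(t) (u - u ∘ Q)`, and the claim is that
`φ(t) = (κ(t) u - v(t))⁺` vanishes on `B`. Testing the inequality for `v(t)` with `φ(t)` shows that
`‖φ(t)‖²` in `L²(B)` is nonincreasing, and it vanishes at `t₀`. Four facts carry this.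

*The eigenfunction.* The only property of `Ψ` used is the mean value inequality that expresses
`Δ u ≥ -|lam|` across `∂B` (`meanDeficit_zeroExtension_le`, recorded in the structure `IsBump`). It
is proved for `C²` functions with compact support by Green's formula on the whole space, and `u` is
a uniform limit of such functions `θ ∘ u`, with `θ` convex and zero near `0`. No regularity of `Ψ`
at the boundary is needed. At a point where `Ψ ≥ 1 / 2` the inequality bounds `∫ u` from below in
terms of `lam` only, so that the constants depend on `Ψ` only through the first eigenvalue.

*The barrier.* On `B` the fractional Laplacian of `u - u ∘ Q` is at most `C u - a` with constants
`C` and `a > 0` (`exists_regLap_antisymm_le`, `exists_energy_antisymm_le`). The kernel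
`‖z‖^(-N-2s)` is the increasing limit of `(ε + ‖z‖²)^(-N/2-s)` as `ε` decreases to `0`. The
derivative in `ε` of the regularized operator is controlled by the mean value inequality, so that
passing from a small fixed `δ` to `ε → 0` costs only `O(δ^(1-s))`; at parameter `δ` the operator is
`C_δ u` minus an integral against `u` of a difference of kernels that is bounded below on `B × B`,
because `B` has distance at least `ρ` from the hyperplane. The same bound on the regularized
energies gives `u ∈ H^s`.

*The maximum principle.* For the antisymmetric function `w = v - κ (u - u ∘ Q)`, whose negative part
on `B` is `φ`, the form `𝓔(w, φ)` is at most a constant times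
`‖v⁻‖_{L^∞(H \ B_{2ρ}(x₀))} ∫ φ` (`energy_negPart_le`). For `σ₁ ≥ q σ₀` this is absorbed by
`-κ a ∫ φ`, which leaves `𝓔(v, φ) ≤ C κ ∫ u φ` (`exists_energy_testFun_le`).

*Time.* The inequality of a supersolution holds for almost every time, with an exceptional set that
depends on the test function. As `v ≥ 0` on `B`, the potential `c` may be replaced by the constant
`-cInf`; then both sides are continuous in time, and the inequality holds at every time
(`energy_ge_of_isSupersolution`). With `γ = C + cInf` this says that the velocity of the curve
`f(t) = κ(t) u - v(t)` in `L²(B)` has nonpositive inner product with `f(t)⁺`, and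
`posPart_eq_zero_of_inner_deriv_nonpos` concludes.
-/

namespace FracParabolic

/-! ### The regularized kernels -/

/-- The kernel `(ε + ‖z‖²)^(-p)`. For `ε = 0` and `p = N / 2 + s` it is the kernel `‖z‖^(-N - 2 s)`
of the fractional Laplacian; for `ε > 0` and `p > N / 2` it is bounded and integrable. -/
noncomputable def regKernel {N : ℕ} (p ε : ℝ) (z : Space N) : ℝ := (ε + ‖z‖ ^ 2) ^ (-p)

section Kernel

variable {N : ℕ} {p ε δ : ℝ}

lemma regKernel_nonneg (hε : 0 ≤ ε) (z : Space N) : 0 ≤ regKernel p ε z := by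
  unfold regKernel; positivity

lemma regKernel_pos (hε : 0 < ε) (z : Space N) : 0 < regKernel p ε z := by
  unfold regKernel; positivity

lemma regKernel_neg (z : Space N) : regKernel p ε (-z) = regKernel p ε z := by
  simp [regKernel]

lemma regKernel_sub_comm (x y : Space N) : regKernel p ε (x - y) = regKernel p ε (y - x) := by
  rw [← regKernel_neg, neg_sub]

lemma continuous_regKernel (hε : 0 < ε) : Continuous (regKernel p ε : Space N → ℝ) := by
  unfold regKernel
  refine Continuous.rpow_const (by fun_prop) fun z => Or.inl ?_
  positivity

lemma measurable_regKernel : Measurable (regKernel p ε : Space N → ℝ) := by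
  unfold regKernel; fun_prop

lemma regKernel_anti (hp : 0 ≤ p) (hε : 0 ≤ ε) (hεδ : ε ≤ δ) {z : Space N} (hz : z ≠ 0) :
    regKernel p δ z ≤ regKernel p ε z := by
  unfold regKernel
  have : 0 < ‖z‖ := norm_pos_iff.2 hz
  exact Real.rpow_le_rpow_of_nonpos (by positivity) (by linarith) (by linarith)

lemma regKernel_anti_of_pos (hp : 0 ≤ p) (hε : 0 < ε) (hεδ : ε ≤ δ) (z : Space N) :
    regKernel p δ z ≤ regKernel p ε z := by
  unfold regKernel
  exact Real.rpow_le_rpow_of_nonpos (by positivity) (by linarith) (by linarith)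

lemma regKernel_le_rpow (hp : 0 ≤ p) (hε : 0 < ε) (z : Space N) : regKernel p ε z ≤ ε ^ (-p) := by
  unfold regKernel
  exact Real.rpow_le_rpow_of_nonpos hε (by nlinarith [sq_nonneg ‖z‖]) (by linarith)

/-- Comparison with the kernel of parameter `1`, for `z` bounded away from the origin or `ε > 0`:
it suffices that `r (1 + ‖z‖²) ≤ ε + ‖z‖²`. -/
lemma regKernel_le_mul_regKernel_one (hp : 0 ≤ p) {r : ℝ} (hr : 0 < r) {z : Space N}
    (h : r * (1 + ‖z‖ ^ 2) ≤ ε + ‖z‖ ^ 2) : regKernel p ε z ≤ r ^ (-p) * regKernel p 1 z := by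
  unfold regKernel
  rw [← Real.mul_rpow hr.le (by positivity)]
  exact Real.rpow_le_rpow_of_nonpos (by positivity) h (by linarith)

lemma integrable_regKernel (hp : (N : ℝ) / 2 < p) (hε : 0 < ε) :
    Integrable (regKernel p ε : Space N → ℝ) := by
  have hp0 : 0 ≤ p := (by positivity : (0 : ℝ) ≤ (N : ℝ) / 2).trans hp.le
  have h1 : Integrable (regKernel p 1 : Space N → ℝ) := by
    have := integrable_rpow_neg_one_add_norm_sq (E := Space N) (μ := volume) (r := 2 * p)
      (by simp; linarith)
    refine this.congr (Eventually.of_forall fun z => ?_)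
    simp only [regKernel]
    ring_nf
  refine (h1.const_mul (min ε 1 ^ (-p))).mono' measurable_regKernel.aestronglyMeasurable
    (Eventually.of_forall fun z => ?_)
  rw [Real.norm_of_nonneg (regKernel_nonneg hε.le z)]
  refine regKernel_le_mul_regKernel_one hp0 (by positivity) ?_
  nlinarith [min_le_left ε 1, min_le_right ε 1, sq_nonneg ‖z‖]

lemma integral_regKernel_pos (hp : (N : ℝ) / 2 < p) (hε : 0 < ε) :
    0 < ∫ z : Space N, regKernel p ε z := by
  rw [integral_pos_iff_support_of_nonneg (fun z => regKernel_nonneg hε.le z)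
    (integrable_regKernel hp hε)]
  have : Function.support (regKernel p ε : Space N → ℝ) = Set.univ := by
    ext z; simp [(regKernel_pos hε z).ne']
  rw [this]
  exact Measure.measure_univ_pos.2 (NeZero.ne _)

/-- Scaling of the kernel: `(r² + ‖r z‖²)^(-p) = r^(-2 p) (1 + ‖z‖²)^(-p)`. -/
lemma regKernel_sq_smul {r : ℝ} (hr : 0 < r) (z : Space N) :
    regKernel p (r ^ 2) (r • z) = (r ^ 2) ^ (-p) * regKernel p 1 z := by
  unfold regKernel
  rw [← Real.mul_rpow (by positivity) (by positivity), norm_smul, Real.norm_of_nonneg hr.le]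
  ring_nf

lemma hasFDerivAt_regKernel (hε : 0 < ε) (z : Space N) :
    HasFDerivAt (regKernel p ε : Space N → ℝ)
      ((-(2 * p) * regKernel (p + 1) ε z) • innerSL ℝ z) z := by
  have h1 : HasFDerivAt (fun z : Space N => ε + ‖z‖ ^ 2) (2 • innerSL ℝ z) z :=
    (hasStrictFDerivAt_norm_sq z).hasFDerivAt.const_add ε
  have h2 := h1.rpow_const (p := -p) (Or.inl (by positivity))
  refine h2.congr_fderiv ?_
  ext y
  simp only [regKernel, smul_apply, smul_eq_mul, nsmul_eq_mul,
    innerSL_apply_apply]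
  rw [neg_add', sub_eq_add_neg]
  push_cast
  simp
  ring

lemma hasDerivAt_regKernel_param (hε : 0 < ε) (z : Space N) :
    HasDerivAt (fun η => regKernel p η z) (-p * regKernel (p + 1) ε z) ε := by
  have h := ((hasDerivAt_id ε).add_const (‖z‖ ^ 2)).rpow_const (p := -p)
    (Or.inl (by simp only [id]; positivity))
  refine HasDerivAt.congr_deriv (f := fun η => regKernel p η z) h ?_
  simp only [regKernel, id, one_mul, neg_add']

/-- `‖z‖ (1 + ‖z‖²)^(-p-1) ≤ (1 + ‖z‖²)^(-p)`. -/
lemma norm_mul_regKernel_add_one_le (z : Space N) :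
    ‖z‖ * regKernel (p + 1) 1 z ≤ regKernel p 1 z := by
  unfold regKernel
  have h : (1 + ‖z‖ ^ 2) ^ (-p) = (1 + ‖z‖ ^ 2) * (1 + ‖z‖ ^ 2) ^ (-(p + 1)) := by
    rw [neg_add', Real.rpow_sub_one (by positivity)]
    field_simp
  rw [h]
  gcongr
  nlinarith [sq_nonneg (‖z‖ - 1)]

end Kernel

/-! ### A mean value inequality for functions with Laplacian bounded below -/

/-- The average deficit of `f` at `x` on the scale `r`:
`∫ (f x - f (x + r z)) (1 + ‖z‖²)^(-p-1) dz`. -/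
noncomputable def meanDeficit {N : ℕ} (p : ℝ) (f : Space N → ℝ) (x : Space N) (r : ℝ) : ℝ :=
  ∫ z, (f x - f (x + r • z)) * regKernel (p + 1) 1 z

section MeanDeficit

variable {N : ℕ} {p : ℝ} {f : Space N → ℝ}

lemma laplacian_eq_sum_fderiv (f : Space N → ℝ) (x : Space N) :
    Laplacian.laplacian f x = ∑ i, fderiv ℝ (fderiv ℝ f) x (EuclideanSpace.basisFun (Fin N) ℝ i)
      (EuclideanSpace.basisFun (Fin N) ℝ i) := by
  rw [InnerProductSpace.laplacian_eq_iteratedFDeriv_orthonormalBasis f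
    (EuclideanSpace.basisFun (Fin N) ℝ)]
  simp [iteratedFDeriv_two_apply]

lemma fderiv_apply_eq_sum (L : Space N →L[ℝ] ℝ) (z : Space N) :
    L z = ∑ i, z i * L (EuclideanSpace.basisFun (Fin N) ℝ i) := by
  conv_lhs => rw [← (EuclideanSpace.basisFun (Fin N) ℝ).sum_repr z]
  simp

lemma hasDerivAt_meanDeficit (hp : (N : ℝ) / 2 < p) (hf : ContDiff ℝ 1 f)
    (hc : HasCompactSupport f) (x : Space N) (r : ℝ) :
    HasDerivAt (meanDeficit p f x)
      (∫ z, -(fderiv ℝ f (x + r • z) z) * regKernel (p + 1) 1 z) r := by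
  have hp0 : 0 ≤ p := (by positivity : (0 : ℝ) ≤ (N : ℝ) / 2).trans hp.le
  have hp1 : (N : ℝ) / 2 < p + 1 := by linarith
  have hf' : Continuous (fderiv ℝ f) := hf.continuous_fderiv (by simp)
  obtain ⟨C, hC⟩ := hf'.bounded_above_of_compact_support (hc.fderiv ℝ)
  obtain ⟨A, hA⟩ := hf.continuous.bounded_above_of_compact_support hc
  have hK := integrable_regKernel hp1 one_pos
  have hKc : Continuous (regKernel (p + 1) 1 : Space N → ℝ) := continuous_regKernel one_pos
  have hfc : Continuous f := hf.continuous
  refine (hasDerivAt_integral_of_dominated_loc_of_deriv_le (s := Set.univ)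
    (bound := fun z => C * regKernel p 1 z)
    (F := fun r z => (f x - f (x + r • z)) * regKernel (p + 1) 1 z)
    (F' := fun r z => -(fderiv ℝ f (x + r • z) z) * regKernel (p + 1) 1 z)
    univ_mem ?_ ?_ ?_ ?_ ?_ ?_).2
  · refine Eventually.of_forall fun r => Continuous.aestronglyMeasurable ?_
    fun_prop
  · refine (hK.const_mul (2 * A)).mono' (Continuous.aestronglyMeasurable (by fun_prop))
      (Eventually.of_forall fun z => ?_)
    rw [norm_mul, Real.norm_of_nonneg (regKernel_nonneg zero_le_one z)]
    refine mul_le_mul_of_nonneg_right ?_ (regKernel_nonneg zero_le_one z)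
    exact (norm_sub_le _ _).trans (by linarith [hA x, hA (x + r • z)])
  · refine Continuous.aestronglyMeasurable ?_
    fun_prop
  · refine Eventually.of_forall fun z r _ => ?_
    rw [norm_mul, Real.norm_of_nonneg (regKernel_nonneg zero_le_one z), norm_neg]
    have hC0 : 0 ≤ C := (norm_nonneg _).trans (hC x)
    calc _ ≤ (C * ‖z‖) * regKernel (p + 1) 1 z := by
          refine mul_le_mul_of_nonneg_right ?_ (regKernel_nonneg zero_le_one z)
          exact (ContinuousLinearMap.le_opNorm _ _).trans
            (mul_le_mul_of_nonneg_right (hC _) (norm_nonneg _))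
      _ = C * (‖z‖ * regKernel (p + 1) 1 z) := by ring
      _ ≤ _ := mul_le_mul_of_nonneg_left (norm_mul_regKernel_add_one_le z) hC0
  · exact (integrable_regKernel hp one_pos).const_mul C
  · refine Eventually.of_forall fun z r _ => ?_
    have h1 : HasDerivAt (fun r : ℝ => x + r • z) z r := by
      simpa using ((hasDerivAt_id r).smul_const z).const_add x
    have h2 := ((hf.differentiable (by simp)) (x + r • z)).hasFDerivAt.comp_hasDerivAt r h1
    exact (h2.const_sub (f x)).mul_const _

lemma hasCompactSupport_comp_add_smul {F : Type*} [Zero F] {g : Space N → F}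
    (hg : HasCompactSupport g) (x : Space N) {r : ℝ} (hr : r ≠ 0) :
    HasCompactSupport fun z => g (x + r • z) :=
  hg.comp_homeomorph ((Homeomorph.smulOfNeZero r hr).trans (Homeomorph.addLeft x))

lemma integral_fderiv_mul_coord_mul_regKernel (hp : 0 < p) (hf : ContDiff ℝ 2 f)
    (hc : HasCompactSupport f) (x : Space N) {r : ℝ} (hr : r ≠ 0) (i : Fin N) :
    ∫ z : Space N, fderiv ℝ f (x + r • z) (EuclideanSpace.basisFun (Fin N) ℝ i) *
        (z i * regKernel (p + 1) 1 z) =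
      (r / (2 * p)) * ∫ z, fderiv ℝ (fderiv ℝ f) (x + r • z)
        (EuclideanSpace.basisFun (Fin N) ℝ i) (EuclideanSpace.basisFun (Fin N) ℝ i) *
          regKernel p 1 z := by
  have hK0 : Continuous (regKernel p 1 : Space N → ℝ) := continuous_regKernel one_pos
  have hK1 : Continuous (regKernel (p + 1) 1 : Space N → ℝ) := continuous_regKernel one_pos
  have hf1 : ContDiff ℝ 1 (fderiv ℝ f) := hf.fderiv_right (by norm_num)
  have hf1c : Continuous (fderiv ℝ f) := hf1.continuous
  have hf2c : Continuous (fderiv ℝ (fderiv ℝ f)) := hf1.continuous_fderiv (by simp)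
  have hc1 := hasCompactSupport_comp_add_smul (hc.fderiv (𝕜 := ℝ)) x hr
  have hc2 := hasCompactSupport_comp_add_smul ((hc.fderiv (𝕜 := ℝ)).fderiv (𝕜 := ℝ)) x hr
  obtain ⟨e, he⟩ : ∃ e, e = EuclideanSpace.basisFun (Fin N) ℝ i := ⟨_, rfl⟩
  rw [← he]
  have hd : ∀ z, HasFDerivAt (fun z => fderiv ℝ f (x + r • z) e)
      (r • (fderiv ℝ (fderiv ℝ f) (x + r • z)).flip e) z := by
    intro z
    have h1 : HasFDerivAt (fun z : Space N => x + r • z) (r • ContinuousLinearMap.id ℝ _) z :=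
      ((hasFDerivAt_id z).const_smul r).const_add x
    have h2 := ((hf1.differentiable (by simp)) (x + r • z)).hasFDerivAt.comp z h1
    refine ((ContinuousLinearMap.apply ℝ ℝ e).hasFDerivAt.comp z h2).congr_fderiv ?_
    ext y
    simp
  have hdK : ∀ z : Space N, fderiv ℝ (regKernel p 1) z e =
      -(2 * p) * (z i * regKernel (p + 1) 1 z) := by
    intro z
    rw [(hasFDerivAt_regKernel one_pos z).fderiv]
    simp [he, EuclideanSpace.inner_single_right]
    ring
  have hdf : ∀ z, fderiv ℝ (fun z => fderiv ℝ f (x + r • z) e) z e =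
      r * fderiv ℝ (fderiv ℝ f) (x + r • z) e e := by
    intro z
    rw [(hd z).fderiv]
    simp
  have hc1i : HasCompactSupport fun z => fderiv ℝ f (x + r • z) e :=
    hc1.mono fun z hz => by
      contrapose! hz
      simp only [Function.mem_support, not_not] at hz ⊢
      rw [hz]; simp
  have hc2i : HasCompactSupport fun z => fderiv ℝ (fderiv ℝ f) (x + r • z) e e :=
    hc2.mono fun z hz => by
      contrapose! hz
      simp only [Function.mem_support, not_not] at hz ⊢
      rw [hz]; simp
  have i1 : Integrable fun z : Space N =>
      r * (fderiv ℝ (fderiv ℝ f) (x + r • z) e e * regKernel p 1 z) :=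
    (Continuous.integrable_of_hasCompactSupport (by fun_prop) hc2i.mul_right).const_mul r
  have i2 : Integrable fun z : Space N =>
      -(2 * p) * (fderiv ℝ f (x + r • z) e * (z i * regKernel (p + 1) 1 z)) :=
    (Continuous.integrable_of_hasCompactSupport (by fun_prop) hc1i.mul_right).const_mul _
  have e1 : ∀ z : Space N, fderiv ℝ f (x + r • z) e * fderiv ℝ (regKernel p 1) z e =
      -(2 * p) * (fderiv ℝ f (x + r • z) e * (z i * regKernel (p + 1) 1 z)) :=
    fun z => by rw [hdK]; ring
  have e2 : ∀ z : Space N, fderiv ℝ (fun z => fderiv ℝ f (x + r • z) e) z e * regKernel p 1 z =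
      r * (fderiv ℝ (fderiv ℝ f) (x + r • z) e e * regKernel p 1 z) :=
    fun z => by rw [hdf]; ring
  have ibp := integral_mul_fderiv_eq_neg_fderiv_mul_of_integrable (μ := volume)
    (f := fun z => fderiv ℝ f (x + r • z) e) (g := regKernel p 1) (v := e)
    (i1.congr (Eventually.of_forall fun z => (e2 z).symm))
    (i2.congr (Eventually.of_forall fun z => (e1 z).symm))
    (Continuous.integrable_of_hasCompactSupport (by fun_prop) hc1i.mul_right)
    (fun z _ => (hd z).differentiableAt)
    (fun z _ => (hasFDerivAt_regKernel one_pos z).differentiableAt)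
  rw [integral_congr_ae (Eventually.of_forall e1), integral_congr_ae (Eventually.of_forall e2),
    integral_const_mul, integral_const_mul] at ibp
  rw [div_mul_eq_mul_div, eq_div_iff (by positivity)]
  linarith

/-- Green's formula against the radial kernel: `z (1 + ‖z‖²)^(-p-1)` is, up to a factor, the
gradient of `(1 + ‖z‖²)^(-p)`. -/
lemma integral_fderiv_mul_regKernel (hp : 0 < p) (hf : ContDiff ℝ 2 f)
    (hc : HasCompactSupport f) (x : Space N) {r : ℝ} (hr : r ≠ 0) :
    ∫ z, -(fderiv ℝ f (x + r • z) z) * regKernel (p + 1) 1 z =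
      -(r / (2 * p)) * ∫ z, Laplacian.laplacian f (x + r • z) * regKernel p 1 z := by
  have hK0 : Continuous (regKernel p 1 : Space N → ℝ) := continuous_regKernel one_pos
  have hK1 : Continuous (regKernel (p + 1) 1 : Space N → ℝ) := continuous_regKernel one_pos
  have hf1 : ContDiff ℝ 1 (fderiv ℝ f) := hf.fderiv_right (by norm_num)
  have hf1c : Continuous (fderiv ℝ f) := hf1.continuous
  have hf2c : Continuous (fderiv ℝ (fderiv ℝ f)) := hf1.continuous_fderiv (by simp)
  have hc1 := hasCompactSupport_comp_add_smul (hc.fderiv (𝕜 := ℝ)) x hr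
  have hc2 := hasCompactSupport_comp_add_smul ((hc.fderiv (𝕜 := ℝ)).fderiv (𝕜 := ℝ)) x hr
  set e := EuclideanSpace.basisFun (Fin N) ℝ with he
  have hI1 : ∀ i, Integrable fun z : Space N =>
      fderiv ℝ f (x + r • z) (e i) * (z i * regKernel (p + 1) 1 z) := fun i =>
    Continuous.integrable_of_hasCompactSupport (by fun_prop) <|
      hc1.mono fun z hz => by
        contrapose! hz
        simp only [Function.mem_support, not_not] at hz ⊢
        rw [hz]; simp
  have hI2 : ∀ i, Integrable fun z : Space N =>
      fderiv ℝ (fderiv ℝ f) (x + r • z) (e i) (e i) * regKernel p 1 z := fun i =>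
    Continuous.integrable_of_hasCompactSupport (by fun_prop) <|
      hc2.mono fun z hz => by
        contrapose! hz
        simp only [Function.mem_support, not_not] at hz ⊢
        rw [hz]; simp
  have l1 : ∀ z, -(fderiv ℝ f (x + r • z) z) * regKernel (p + 1) 1 z =
      -∑ i, fderiv ℝ f (x + r • z) (e i) * (z i * regKernel (p + 1) 1 z) := by
    intro z
    rw [fderiv_apply_eq_sum (fderiv ℝ f (x + r • z)) z, neg_mul, Finset.sum_mul]
    congr 1
    exact Finset.sum_congr rfl fun i _ => by ring
  have l2 : ∀ z, Laplacian.laplacian f (x + r • z) * regKernel p 1 z =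
      ∑ i, fderiv ℝ (fderiv ℝ f) (x + r • z) (e i) (e i) * regKernel p 1 z := by
    intro z
    rw [laplacian_eq_sum_fderiv, Finset.sum_mul]
  rw [integral_congr_ae (Eventually.of_forall l1), integral_congr_ae (Eventually.of_forall l2),
    integral_neg, integral_finsetSum _ fun i _ => hI1 i,
    integral_finsetSum _ fun i _ => hI2 i,
    Finset.sum_congr rfl fun i _ => integral_fderiv_mul_coord_mul_regKernel hp hf hc x hr i,
    ← Finset.mul_sum, neg_mul]

/-- If `Δ f ≥ -Λ`, then `f` exceeds its average on the scale `r` by at most a multiple of `r²`. -/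
lemma meanDeficit_le_of_laplacian_ge (hp : (N : ℝ) / 2 < p) (hp0 : 0 < p) (hf : ContDiff ℝ 2 f)
    (hc : HasCompactSupport f) {Λ : ℝ} (hΛ : ∀ x, -Λ ≤ Laplacian.laplacian f x) (x : Space N)
    {r : ℝ} (hr : 0 ≤ r) :
    meanDeficit p f x r ≤ Λ / (4 * p) * (∫ z : Space N, regKernel p 1 z) * r ^ 2 := by
  set I := ∫ z : Space N, regKernel p 1 z with hI
  have hd := hasDerivAt_meanDeficit hp (hf.of_le (by norm_num)) hc x
  have hf2c : Continuous (Laplacian.laplacian f) := by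
    have : Laplacian.laplacian f = fun x => ∑ i, fderiv ℝ (fderiv ℝ f) x
        (EuclideanSpace.basisFun (Fin N) ℝ i) (EuclideanSpace.basisFun (Fin N) ℝ i) :=
      funext fun x => laplacian_eq_sum_fderiv f x
    rw [this]
    have hf1 : ContDiff ℝ 1 (fderiv ℝ f) := hf.fderiv_right (by norm_num)
    have := hf1.continuous_fderiv (by simp)
    fun_prop
  have hlc : HasCompactSupport (Laplacian.laplacian f) := by
    refine ((hc.fderiv (𝕜 := ℝ)).fderiv (𝕜 := ℝ)).mono fun z hz => ?_
    contrapose! hz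
    simp only [Function.mem_support, not_not] at hz ⊢
    rw [laplacian_eq_sum_fderiv, hz]; simp
  have hd2 : ∀ r, HasDerivAt (fun r => Λ / (4 * p) * I * r ^ 2 - meanDeficit p f x r) _ r :=
    fun r => ((hasDerivAt_pow 2 r).const_mul _).sub (hd r)
  have hmono : MonotoneOn (fun r => Λ / (4 * p) * I * r ^ 2 - meanDeficit p f x r)
      (Set.Ici 0) := by
    refine monotoneOn_of_deriv_nonneg (convex_Ici 0) ?_ ?_ ?_
    · exact fun r _ => (hd2 r).continuousAt.continuousWithinAt
    · exact fun r _ => (hd2 r).differentiableAt.differentiableWithinAt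
    · intro r hr
      have hr : 0 < r := by simpa using hr
      rw [(hd2 r).deriv,
        integral_fderiv_mul_regKernel hp0 hf hc x hr.ne']
      have hcomp : HasCompactSupport fun z => Laplacian.laplacian f (x + r • z) :=
        hasCompactSupport_comp_add_smul hlc x hr.ne'
      have hK := continuous_regKernel (N := N) (p := p) one_pos
      have : -Λ * I ≤ ∫ z, Laplacian.laplacian f (x + r • z) * regKernel p 1 z := by
        rw [hI, ← integral_const_mul]
        refine integral_mono ((integrable_regKernel hp one_pos).const_mul _)
          (Continuous.integrable_of_hasCompactSupport (by fun_prop) hcomp.mul_right) fun z => ?_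
        exact mul_le_mul_of_nonneg_right (hΛ _) (regKernel_nonneg zero_le_one z)
      have h2 : 0 ≤ r / (2 * p) := by positivity
      have h3 := mul_le_mul_of_nonneg_left this h2
      have h4 : Λ / (4 * p) * I * (((2 : ℕ) : ℝ) * r ^ (2 - 1)) = -(r / (2 * p) * (-Λ * I)) := by
        simp only [Nat.cast_ofNat, Nat.add_one_sub_one, pow_one]
        field_simp
        ring
      rw [h4]
      linarith
  have := hmono (Set.mem_Ici.2 le_rfl) (Set.mem_Ici.2 hr) hr
  simpa [meanDeficit] using this

end MeanDeficit

/-! ### The mean value inequality for the zero extension of an eigenfunction -/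

/-- A smooth convex function that vanishes on `(-∞, h]` and differs from `t ↦ max t 0` by at most
`2 h`: a rescaled primitive of `Real.smoothTransition`. -/
noncomputable def smoothRamp (h t : ℝ) : ℝ :=
  h * ∫ τ in (0 : ℝ)..(t / h - 1), Real.smoothTransition τ

section SmoothRamp

variable {h t : ℝ}

lemma hasDerivAt_smoothRamp (hh : 0 < h) (t : ℝ) :
    HasDerivAt (smoothRamp h) (Real.smoothTransition (t / h - 1)) t := by
  have h1 : HasDerivAt (fun a => ∫ τ in (0 : ℝ)..a, Real.smoothTransition τ)
      (Real.smoothTransition (t / h - 1)) (t / h - 1) :=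
    intervalIntegral.integral_hasDerivAt_right
      (Real.smoothTransition.continuous.intervalIntegrable _ _)
      (Real.smoothTransition.continuous.stronglyMeasurableAtFilter _ _)
      Real.smoothTransition.continuous.continuousAt
  have h2 : HasDerivAt (fun t => t / h - 1) (1 / h) t :=
    ((hasDerivAt_id t).div_const h).sub_const 1
  refine ((h1.comp t h2).const_mul h).congr_deriv ?_
  field_simp

lemma deriv_smoothRamp (hh : 0 < h) :
    deriv (smoothRamp h) = fun t => Real.smoothTransition (t / h - 1) :=
  funext fun t => (hasDerivAt_smoothRamp hh t).deriv

lemma monotone_smoothRamp (hh : 0 < h) : Monotone (smoothRamp h) :=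
  monotone_of_deriv_nonneg (fun t => (hasDerivAt_smoothRamp hh t).differentiableAt) fun t => by
    rw [(hasDerivAt_smoothRamp hh t).deriv]; exact Real.smoothTransition.nonneg _

lemma contDiff_smoothRamp (hh : 0 < h) : ContDiff ℝ 2 (smoothRamp h) := by
  rw [show (2 : WithTop ℕ∞) = 1 + 1 from by norm_num, contDiff_succ_iff_deriv]
  refine ⟨fun t => (hasDerivAt_smoothRamp hh t).differentiableAt, by simp, ?_⟩
  rw [deriv_smoothRamp hh]
  exact (Real.smoothTransition.contDiff (n := 1)).comp (by fun_prop)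

lemma smoothRamp_eq_zero (hh : 0 < h) (ht : t ≤ h) : smoothRamp h t = 0 := by
  have ht' : t / h - 1 ≤ 0 := by rw [sub_nonpos, div_le_one hh]; exact ht
  unfold smoothRamp
  rw [intervalIntegral.integral_symm,
    intervalIntegral.integral_congr (g := fun _ => (0 : ℝ)) fun τ hτ => ?_]
  · simp
  · rw [Set.uIcc_of_le ht'] at hτ
    exact Real.smoothTransition.zero_of_nonpos hτ.2

lemma smoothRamp_le (hh : 0 < h) (ht : 0 ≤ t) : smoothRamp h t ≤ t := by
  have hm : Monotone fun t => t - smoothRamp h t := by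
    have hd : ∀ t, HasDerivAt (fun t => t - smoothRamp h t) _ t :=
      fun t => (hasDerivAt_id t).sub (hasDerivAt_smoothRamp hh t)
    refine monotone_of_deriv_nonneg (fun t => (hd t).differentiableAt) fun t => ?_
    rw [(hd t).deriv]
    linarith [Real.smoothTransition.le_one (t / h - 1)]
  have := hm ht
  simp only [smoothRamp_eq_zero hh hh.le] at this
  linarith

lemma le_smoothRamp_add (hh : 0 < h) (t : ℝ) : t ≤ smoothRamp h t + 2 * h := by
  have hd : ∀ t, HasDerivAt (fun t => t - smoothRamp h t) _ t :=
    fun t => (hasDerivAt_id t).sub (hasDerivAt_smoothRamp hh t)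
  rcases le_total t (2 * h) with ht | ht
  · rcases le_total t 0 with h0 | h0
    · rw [smoothRamp_eq_zero hh (h0.trans hh.le)]; linarith
    · have := monotone_smoothRamp hh h0
      rw [smoothRamp_eq_zero hh hh.le] at this
      linarith
  · have hm : AntitoneOn (fun t => t - smoothRamp h t) (Set.Ici (2 * h)) := by
      refine antitoneOn_of_deriv_nonpos (convex_Ici _)
        (fun t _ => (hd t).continuousAt.continuousWithinAt)
        (fun t _ => (hd t).differentiableAt.differentiableWithinAt) fun t ht => ?_
      rw [interior_Ici] at ht
      rw [(hd t).deriv, Real.smoothTransition.one_of_one_le]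
      · simp
      · rw [le_sub_iff_add_le, le_div_iff₀ hh]
        linarith [Set.mem_Ioi.1 ht]
    have h1 := hm (Set.mem_Ici.2 le_rfl) (Set.mem_Ici.2 ht) ht
    have h2 := monotone_smoothRamp hh (show (0 : ℝ) ≤ 2 * h by linarith)
    rw [smoothRamp_eq_zero hh hh.le] at h2
    simp only at h1
    linarith

lemma deriv_deriv_smoothRamp_nonneg (hh : 0 < h) (t : ℝ) :
    0 ≤ deriv (deriv (smoothRamp h)) t := by
  refine Monotone.deriv_nonneg ?_
  rw [deriv_smoothRamp hh]
  intro a b hab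
  refine Real.smoothTransition.monotone ?_
  have := div_le_div_of_nonneg_right hab hh.le
  linarith

end SmoothRamp

section ZeroExtension

variable {N : ℕ} {p : ℝ}

/-- For convex `R`, `Δ (R ∘ g) ≥ R'(g) Δ g`. -/
lemma le_laplacian_comp {R : ℝ → ℝ} {g : Space N → ℝ} {x : Space N} (hR : ContDiff ℝ 2 R)
    (hR2 : 0 ≤ deriv (deriv R) (g x)) (hg : ContDiffAt ℝ 2 g x) :
    deriv R (g x) * Laplacian.laplacian g x ≤ Laplacian.laplacian (R ∘ g) x := by
  have hR1 : ContDiff ℝ 1 (deriv R) := by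
    have := hR
    rw [show (2 : WithTop ℕ∞) = 1 + 1 from by norm_num, contDiff_succ_iff_deriv] at this
    exact this.2.2
  have hev : fderiv ℝ (R ∘ g) =ᶠ[𝓝 x] fun y => deriv R (g y) • fderiv ℝ g y := by
    filter_upwards [hg.eventually (by simp)] with y hy
    have h1 := ((hR.differentiable (by simp)) (g y)).hasDerivAt
    exact (h1.comp_hasFDerivAt y (hy.differentiableAt (by simp)).hasFDerivAt).fderiv
  have hg1 : DifferentiableAt ℝ (fderiv ℝ g) x :=
    (hg.fderiv_right (m := 1) (by norm_num)).differentiableAt (by simp)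
  have hd1 : HasFDerivAt (fun y => deriv R (g y)) (deriv (deriv R) (g x) • fderiv ℝ g x) x :=
    (((hR1.differentiable (by simp)) (g x)).hasDerivAt).comp_hasFDerivAt x
      (hg.differentiableAt (by simp)).hasFDerivAt
  have hd : HasFDerivAt (fun y => deriv R (g y) • fderiv ℝ g y) _ x := hd1.smul hg1.hasFDerivAt
  rw [laplacian_eq_sum_fderiv, laplacian_eq_sum_fderiv, hev.fderiv_eq, hd.fderiv,
    Finset.mul_sum]
  refine Finset.sum_le_sum fun i _ => ?_
  have := mul_nonneg hR2 (mul_self_nonneg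
    (fderiv ℝ g x (EuclideanSpace.basisFun (Fin N) ℝ i)))
  simp only [add_apply, smul_apply, ContinuousLinearMap.smulRight_apply, smul_eq_mul]
  linarith

variable {ρ lam : ℝ} {Ψ : Space N → ℝ}

lemma continuous_zeroExtension (hρ : 0 < ρ) (hΨ : IsDirichletEigenfunction ρ lam Ψ) :
    Continuous ((Metric.ball (0 : Space N) ρ).indicator Ψ) := by
  refine continuous_indicator ?_ ?_
  · rw [frontier_ball _ hρ.ne']; exact hΨ.2.2.2.1
  · rw [closure_ball _ hρ.ne']; exact hΨ.2.1

/-- The zero extension of a nonnegative eigenfunction satisfies `Δ ≥ -|lam|` in the sense of the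
mean value inequality. It is a uniform limit of `C²` functions with compact support whose
Laplacian is at least `-|lam|`, obtained by composing with smooth convex functions that vanish
near `0`. -/
lemma meanDeficit_zeroExtension_le (hρ : 0 < ρ) (hp : (N : ℝ) / 2 < p) (hp0 : 0 < p)
    (hΨ : IsDirichletEigenfunction ρ lam Ψ)
    (h0 : ∀ x ∈ Metric.ball (0 : Space N) ρ, 0 < Ψ x)
    (h1 : ∀ x ∈ Metric.ball (0 : Space N) ρ, Ψ x ≤ 1) (x : Space N) {r : ℝ} (hr : 0 ≤ r) :
    meanDeficit p ((Metric.ball (0 : Space N) ρ).indicator Ψ) x r ≤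
      |lam| / (4 * p) * (∫ z : Space N, regKernel p 1 z) * r ^ 2 := by
  set u := (Metric.ball (0 : Space N) ρ).indicator Ψ with hu
  have huc : Continuous u := continuous_zeroExtension hρ hΨ
  have hu0 : ∀ x, 0 ≤ u x := fun x => Set.indicator_nonneg (fun x hx => (h0 x hx).le) x
  have hu1 : ∀ x, u x ≤ 1 := fun x =>
    Set.indicator_apply_le' (fun hx => h1 x hx) fun _ => zero_le_one
  set J := ∫ z : Space N, regKernel (p + 1) 1 z with hJ
  have hKint := integrable_regKernel (N := N) (p := p + 1) (by linarith) one_pos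
  have hKc := continuous_regKernel (N := N) (p := p + 1) one_pos
  have key : ∀ h > 0, meanDeficit p u x r ≤
      |lam| / (4 * p) * (∫ z : Space N, regKernel p 1 z) * r ^ 2 + h * (2 * J) := by
    intro h hh
    have hRc : Continuous (smoothRamp h) := (contDiff_smoothRamp hh).continuous
    have hlocin : ∀ y ∈ Metric.ball (0 : Space N) ρ, u =ᶠ[𝓝 y] Ψ := fun y hy => by
      filter_upwards [Metric.isOpen_ball.mem_nhds hy] with z hz
      simp [hu, hz]
    have hlocout : ∀ y ∉ Metric.ball (0 : Space N) ρ,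
        (smoothRamp h ∘ u) =ᶠ[𝓝 y] fun _ => (0 : ℝ) := fun y hy => by
      have : u y < h := by simpa [hu, Set.indicator_of_notMem hy] using hh
      filter_upwards [huc.continuousAt.eventually (gt_mem_nhds this)] with z hz
      exact smoothRamp_eq_zero hh hz.le
    have hΨ2 : ∀ y ∈ Metric.ball (0 : Space N) ρ, ContDiffAt ℝ 2 u y := fun y hy =>
      (hΨ.1.contDiffAt (Metric.isOpen_ball.mem_nhds hy)).congr_of_eventuallyEq (hlocin y hy)
    have hsm : ContDiff ℝ 2 (smoothRamp h ∘ u) := by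
      rw [contDiff_iff_contDiffAt]
      intro y
      by_cases hy : y ∈ Metric.ball (0 : Space N) ρ
      · exact (contDiff_smoothRamp hh).contDiffAt.comp y (hΨ2 y hy)
      · exact contDiffAt_const.congr_of_eventuallyEq (hlocout y hy)
    have hcs : HasCompactSupport (smoothRamp h ∘ u) := by
      refine HasCompactSupport.intro (isCompact_closedBall (0 : Space N) ρ) fun y hy => ?_
      exact (hlocout y fun hy' => hy (Metric.ball_subset_closedBall hy')).self_of_nhds
    have hlap : ∀ y, -|lam| ≤ Laplacian.laplacian (smoothRamp h ∘ u) y := by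
      intro y
      by_cases hy : y ∈ Metric.ball (0 : Space N) ρ
      -- inside the ball `Δ (θ ∘ u) ≥ -θ'(u) lam u`, with `0 ≤ θ' ≤ 1` and `0 ≤ u ≤ 1`
      · refine le_trans ?_ (le_laplacian_comp (contDiff_smoothRamp hh)
          (deriv_deriv_smoothRamp_nonneg hh _) (hΨ2 y hy))
        rw [InnerProductSpace.laplacian_congr_nhds (hlocin y hy) |>.self_of_nhds,
          ← neg_neg (Laplacian.laplacian Ψ y), hΨ.2.2.1 y hy, deriv_smoothRamp hh]
        have hS0 := Real.smoothTransition.nonneg (u y / h - 1)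
        have hS1 := Real.smoothTransition.le_one (u y / h - 1)
        have a1 : lam * Ψ y ≤ |lam| :=
          (mul_le_mul_of_nonneg_right (le_abs_self lam) (h0 y hy).le).trans
            (mul_le_of_le_one_right (abs_nonneg _) (h1 y hy))
        nlinarith [mul_le_mul_of_nonneg_left a1 hS0, mul_le_of_le_one_left (abs_nonneg lam) hS1]
      · rw [InnerProductSpace.laplacian_congr_nhds (hlocout y hy) |>.self_of_nhds]
        simp
    have hD := meanDeficit_le_of_laplacian_ge hp hp0 hsm hcs hlap x hr
    have hle : meanDeficit p u x r ≤ meanDeficit p (smoothRamp h ∘ u) x r + h * (2 * J) := by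
      have e1 : h * (2 * J) = ∫ z : Space N, 2 * h * regKernel (p + 1) 1 z := by
        rw [integral_const_mul, ← hJ]; ring
      have hb : ∀ w : Space N → ℝ, Continuous w → (∀ y, 0 ≤ w y) → (∀ y, w y ≤ 1) →
          Integrable fun z => (w x - w (x + r • z)) * regKernel (p + 1) 1 z := by
        intro w hw hw0 hw1
        refine hKint.mono' (Continuous.aestronglyMeasurable (by fun_prop))
          (Eventually.of_forall fun z => ?_)
        rw [norm_mul, Real.norm_of_nonneg (regKernel_nonneg zero_le_one z)]
        refine mul_le_of_le_one_left (regKernel_nonneg zero_le_one z) ?_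
        rw [Real.norm_eq_abs, abs_le]
        constructor <;> linarith [hw0 x, hw1 x, hw0 (x + r • z), hw1 (x + r • z)]
      have hRu1 : ∀ y, (smoothRamp h ∘ u) y ≤ u y := fun y => smoothRamp_le hh (hu0 y)
      have hRu0 : ∀ y, 0 ≤ (smoothRamp h ∘ u) y := fun y => by
        have := monotone_smoothRamp hh (hu0 y)
        rwa [smoothRamp_eq_zero hh hh.le] at this
      have i2 := hb _ (hRc.comp huc) hRu0 fun y => (hRu1 y).trans (hu1 y)
      unfold meanDeficit
      rw [e1, ← integral_add i2 (hKint.const_mul _)]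
      refine integral_mono (hb u huc hu0 hu1) (i2.add (hKint.const_mul _)) fun z => ?_
      have a1 := le_smoothRamp_add hh (u x)
      have a2 := hRu1 (x + r • z)
      have a3 : u x - u (x + r • z) ≤
          ((smoothRamp h ∘ u) x - (smoothRamp h ∘ u) (x + r • z)) + 2 * h := by
        simp only [Function.comp] at a2 ⊢
        linarith
      have := mul_le_mul_of_nonneg_right a3 (regKernel_nonneg (p := p + 1) zero_le_one z)
      simp only
      linarith
    linarith
  have hlim : Tendsto (fun h : ℝ => |lam| / (4 * p) * (∫ z : Space N, regKernel p 1 z) * r ^ 2 +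
      h * (2 * J)) (𝓝[>] 0) (𝓝 (|lam| / (4 * p) * (∫ z : Space N, regKernel p 1 z) * r ^ 2 +
      0 * (2 * J))) := by
    refine Tendsto.mono_left ?_ nhdsWithin_le_nhds
    exact (Continuous.tendsto (by fun_prop) _)
  rw [zero_mul, add_zero] at hlim
  exact ge_of_tendsto hlim (by filter_upwards [self_mem_nhdsWithin] with h hh using key h hh)

end ZeroExtension

/-! ### The regularized fractional Laplacian of a bump -/

/-- A measurable function with values in `[0, 1]` that vanishes outside `B_ρ(x₀)` and exceeds its
averages on the scale `r` by at most `A r²`. -/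
structure IsBump {N : ℕ} (p A ρ : ℝ) (x₀ : Space N) (u : Space N → ℝ) : Prop where
  measurable : Measurable u
  nonneg : ∀ x, 0 ≤ u x
  le_one : ∀ x, u x ≤ 1
  eq_zero : ∀ x ∉ Metric.ball x₀ ρ, u x = 0
  meanDeficit_le : ∀ x r, 0 ≤ r → meanDeficit p u x r ≤ A * r ^ 2

/-- The fractional Laplacian with the regularized kernel and without the normalization constant. -/
noncomputable def regLap {N : ℕ} (p ε : ℝ) (u : Space N → ℝ) (x : Space N) : ℝ :=
  ∫ z, (u x - u (x + z)) * regKernel p ε z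

section Bump

variable {N : ℕ} {p s A ρ : ℝ} {x₀ : Space N} {u : Space N → ℝ}

lemma IsBump.abs_sub_le (hu : IsBump p A ρ x₀ u) (x y : Space N) : |u x - u y| ≤ 1 := by
  rw [abs_le]
  constructor <;> linarith [hu.nonneg x, hu.nonneg y, hu.le_one x, hu.le_one y]

lemma IsBump.integrable (hu : IsBump p A ρ x₀ u) : Integrable u := by
  have hb : Integrable ((Metric.ball x₀ ρ).indicator fun _ => (1 : ℝ)) :=
    (integrable_indicator_iff measurableSet_ball).2
      (integrableOn_const (by exact measure_ball_lt_top.ne))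
  refine hb.mono' hu.measurable.aestronglyMeasurable (Eventually.of_forall fun x => ?_)
  rw [Real.norm_of_nonneg (hu.nonneg x)]
  by_cases hx : x ∈ Metric.ball x₀ ρ
  · simpa [hx] using hu.le_one x
  · simp [hx, hu.eq_zero x hx]

lemma IsBump.integrable_sub_mul (hu : IsBump p A ρ x₀ u) (x : Space N) {K : Space N → ℝ}
    (hK : Integrable K) {r : ℝ} : Integrable fun z => (u x - u (x + r • z)) * K z := by
  have := hu.measurable
  refine hK.norm.mono' (AEStronglyMeasurable.mul (Measurable.aestronglyMeasurable (by fun_prop))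
    hK.aestronglyMeasurable) (Eventually.of_forall fun z => ?_)
  rw [norm_mul]
  exact mul_le_of_le_one_left (norm_nonneg _) (hu.abs_sub_le _ _)

/-- A bump that is at least `1 / 2` somewhere has integral bounded below, by the mean value
inequality at that point. -/
lemma exists_le_integral_of_isBump (hp : (N : ℝ) / 2 < p) (A : ℝ) :
    ∃ m > (0 : ℝ), ∀ (ρ : ℝ) (x₀ : Space N) (u : Space N → ℝ), IsBump p A ρ x₀ u →
      (∃ x, 1 / 2 ≤ u x) → m ≤ ∫ x, u x := by
  have hp1 : (N : ℝ) / 2 < p + 1 := by linarith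
  set I := ∫ z : Space N, regKernel (p + 1) 1 z with hI
  have hI0 : 0 < I := integral_regKernel_pos hp1 one_pos
  have hK := integrable_regKernel (N := N) hp1 one_pos
  obtain ⟨r, hr, hAr⟩ : ∃ r > 0, A * r ^ 2 < I / 4 := by
    have h1 : Tendsto (fun r : ℝ => A * r ^ 2) (𝓝[>] 0) (𝓝 (A * 0 ^ 2)) :=
      (Continuous.tendsto (by fun_prop) _).mono_left nhdsWithin_le_nhds
    rw [zero_pow two_ne_zero, mul_zero] at h1
    obtain ⟨r, h2, h3⟩ := ((h1.eventually (gt_mem_nhds (show 0 < I / 4 by positivity))).and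
      self_mem_nhdsWithin).exists
    exact ⟨r, h3, h2⟩
  refine ⟨r ^ N * (I / 4), by positivity, fun ρ x₀ u hu ⟨x, hx⟩ => ?_⟩
  have hD := hu.meanDeficit_le x r hr.le
  have hum := hu.measurable
  have hushift : Integrable fun z => u (x + r • z) :=
    ((hu.integrable.comp_add_left x).comp_smul hr.ne')
  have hi2 : Integrable fun z => u (x + r • z) * regKernel (p + 1) 1 z := by
    have := (hK.const_mul (u x)).sub (hu.integrable_sub_mul x hK (r := r))
    refine this.congr (Eventually.of_forall fun z => ?_)
    simp only [Pi.sub_apply]; ring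
  have hsplit : meanDeficit p u x r = u x * I - ∫ z, u (x + r • z) * regKernel (p + 1) 1 z := by
    unfold meanDeficit
    rw [hI, ← integral_const_mul, ← integral_sub (hK.const_mul _) hi2]
    exact integral_congr_ae (Eventually.of_forall fun z => by simp only; ring)
  have hle : ∫ z, u (x + r • z) * regKernel (p + 1) 1 z ≤ ∫ z, u (x + r • z) := by
    refine integral_mono hi2 hushift fun z => ?_
    refine mul_le_of_le_one_right (hu.nonneg _) ?_
    have hp0 : 0 ≤ p + 1 := (by positivity : (0 : ℝ) ≤ (N : ℝ) / 2).trans hp1.le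
    simpa using regKernel_le_rpow hp0 one_pos z
  have hcv : ∫ z, u (x + r • z) = (r ^ N)⁻¹ * ∫ y, u y := by
    rw [Measure.integral_comp_smul volume (fun z => u (x + z)) r,
      integral_add_left_eq_self u x]
    simp [abs_of_pos hr]
  have h1 : I / 4 ≤ (r ^ N)⁻¹ * ∫ y, u y := by
    rw [← hcv]
    nlinarith
  rwa [inv_mul_eq_div, le_div_iff₀ (by positivity), mul_comm] at h1

lemma IsBump.hasDerivAt_regLap (hu : IsBump p A ρ x₀ u) (hp : (N : ℝ) / 2 < p) (x : Space N)
    {ε : ℝ} (hε : 0 < ε) :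
    HasDerivAt (fun ε => regLap p ε u x)
      (∫ z, (u x - u (x + z)) * (-p * regKernel (p + 1) ε z)) ε := by
  have hp0 : 0 ≤ p := (by positivity : (0 : ℝ) ≤ (N : ℝ) / 2).trans hp.le
  have hK2 := integrable_regKernel (N := N) (p := p + 1) (by linarith) (half_pos hε)
  have hum := hu.measurable
  have hint : ∀ {K : Space N → ℝ}, Integrable K → Integrable fun z => (u x - u (x + z)) * K z :=
    fun hK => by simpa using hu.integrable_sub_mul x hK (r := 1)
  refine (hasDerivAt_integral_of_dominated_loc_of_deriv_le (s := Set.Ioi (ε / 2))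
    (bound := fun z => p * regKernel (p + 1) (ε / 2) z)
    (F := fun ε z => (u x - u (x + z)) * regKernel p ε z)
    (F' := fun ε z => (u x - u (x + z)) * (-p * regKernel (p + 1) ε z))
    (Ioi_mem_nhds (by linarith)) ?_ ?_ ?_ ?_ ?_ ?_).2
  · refine Eventually.of_forall fun η => Measurable.aestronglyMeasurable ?_
    have := measurable_regKernel (N := N) (p := p) (ε := η)
    fun_prop
  · exact hint (integrable_regKernel hp hε)
  · have := measurable_regKernel (N := N) (p := p + 1) (ε := ε)
    exact Measurable.aestronglyMeasurable (by fun_prop)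
  · refine Eventually.of_forall fun z η hη => ?_
    have hη : ε / 2 < η := hη
    have hη0 : 0 < η := by linarith
    rw [norm_mul, norm_mul, norm_neg, Real.norm_of_nonneg hp0,
      Real.norm_of_nonneg (regKernel_nonneg hη0.le z)]
    refine (mul_le_of_le_one_left (mul_nonneg hp0 (regKernel_nonneg hη0.le z))
      (hu.abs_sub_le _ _)).trans ?_
    exact mul_le_mul_of_nonneg_left
      (regKernel_anti_of_pos (by linarith) (half_pos hε) hη.le z) hp0
  · exact hK2.const_mul p
  · refine Eventually.of_forall fun z η hη => ?_
    have hη : ε / 2 < η := hη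
    exact (hasDerivAt_regKernel_param (by linarith) z).const_mul _

lemma IsBump.integral_sub_mul_regKernel_le (hu : IsBump (N / 2 + s) A ρ x₀ u) (x : Space N)
    {ε : ℝ} (hε : 0 < ε) :
    ∫ z, (u x - u (x + z)) * regKernel ((N : ℝ) / 2 + s + 1) ε z ≤ A * ε ^ (-s) := by
  obtain ⟨r, hr, rfl⟩ : ∃ r > 0, ε = r ^ 2 := ⟨√ε, Real.sqrt_pos.2 hε, (Real.sq_sqrt hε.le).symm⟩
  set p : ℝ := N / 2 + s with hp
  have h1 := Measure.integral_comp_smul volume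
    (fun z => (u x - u (x + z)) * regKernel (p + 1) (r ^ 2) z) r
  have h2 : ∀ z, (u x - u (x + r • z)) * regKernel (p + 1) (r ^ 2) (r • z) =
      (r ^ 2) ^ (-(p + 1)) * ((u x - u (x + r • z)) * regKernel (p + 1) 1 z) := fun z => by
    rw [regKernel_sq_smul hr]; ring
  rw [integral_congr_ae (Eventually.of_forall h2), integral_const_mul] at h1
  have h3 := hu.meanDeficit_le x r hr.le
  unfold meanDeficit at h3
  set D := ∫ z, (u x - u (x + r • z)) * regKernel (p + 1) 1 z
  set F := ∫ z, (u x - u (x + z)) * regKernel (p + 1) (r ^ 2) z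
  simp only [finrank_euclideanSpace, Fintype.card_fin, smul_eq_mul] at h1
  rw [abs_of_pos (by positivity), inv_mul_eq_div, eq_div_iff (by positivity)] at h1
  rw [← h1]
  have h4 : (r ^ 2) ^ (-(p + 1)) * (A * r ^ 2) * r ^ N = A * (r ^ 2) ^ (-s) := by
    have e1 : r ^ N = (r ^ 2) ^ ((N : ℝ) / 2) := by
      rw [← Real.rpow_natCast r 2, ← Real.rpow_mul hr.le, ← Real.rpow_natCast]
      congr 1; push_cast; ring
    have e2 : (r ^ 2) ^ (-s) = (r ^ 2) ^ (-(p + 1)) * (r ^ 2) ^ (1 : ℝ) *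
        (r ^ 2) ^ ((N : ℝ) / 2) := by
      rw [← Real.rpow_add (by positivity), ← Real.rpow_add (by positivity)]
      congr 1; rw [hp]; ring
    rw [e1, e2, Real.rpow_one]
    ring
  rw [← h4]
  gcongr

/-- The part of the regularized fractional Laplacian coming from the scales between `√ε` and `√δ`
is at most a multiple of `δ^(1-s)`. -/
lemma IsBump.regLap_le (hu : IsBump (N / 2 + s) A ρ x₀ u) (hA : 0 ≤ A) (hs0 : 0 < s) (hs1 : s < 1)
    (x : Space N) {ε δ : ℝ} (hε : 0 < ε) (hεδ : ε ≤ δ) :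
    regLap (N / 2 + s) ε u x ≤
      regLap (N / 2 + s) δ u x + (N / 2 + s) * A / (1 - s) * δ ^ (1 - s) := by
  set p : ℝ := N / 2 + s with hp
  have hp0 : 0 < p := by positivity
  have hs1' : 0 < 1 - s := by linarith
  have hd : ∀ η > 0, HasDerivAt (fun η => regLap p η u x + p * A / (1 - s) * η ^ (1 - s)) _ η :=
    fun η hη => (hu.hasDerivAt_regLap (by linarith) x hη).add
      ((Real.hasDerivAt_rpow_const (p := 1 - s) (Or.inl hη.ne')).const_mul _)
  have hm : MonotoneOn (fun η => regLap p η u x + p * A / (1 - s) * η ^ (1 - s))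
      (Set.Ioi 0) := by
    refine monotoneOn_of_deriv_nonneg (convex_Ioi _)
      (fun η hη => (hd η hη).continuousAt.continuousWithinAt)
      (fun η hη => (hd η (interior_subset hη)).differentiableAt.differentiableWithinAt)
      fun η hη => ?_
    have hη : 0 < η := interior_subset hη
    rw [(hd η hη).deriv]
    have h1 := hu.integral_sub_mul_regKernel_le x hη
    have h2 : ∀ z, (u x - u (x + z)) * (-p * regKernel (p + 1) η z) =
        -p * ((u x - u (x + z)) * regKernel (p + 1) η z) := fun z => by ring
    rw [integral_congr_ae (Eventually.of_forall h2), integral_const_mul]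
    have h3 : p * A / (1 - s) * ((1 - s) * η ^ (1 - s - 1)) = p * (A * η ^ (-s)) := by
      rw [show 1 - s - 1 = -s by ring]
      field_simp
    rw [h3]
    have := mul_le_mul_of_nonneg_left h1 hp0.le
    linarith
  have h := hm (Set.mem_Ioi.2 hε) (Set.mem_Ioi.2 (hε.trans_le hεδ)) hεδ
  simp only at h
  have : 0 ≤ p * A / (1 - s) * ε ^ (1 - s) := by positivity
  linarith

end Bump

/-! ### The reflection -/

section Reflection

variable {N : ℕ} {e : Space N} {b : ℝ}

lemma inner_reflect (he : ‖e‖ = 1) (x : Space N) :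
    inner ℝ e (reflect e b x) - b = -(inner ℝ e x - b) := by
  simp only [reflect, inner_sub_right, inner_smul_right, real_inner_self_eq_norm_sq, he]
  ring

lemma reflect_reflect (he : ‖e‖ = 1) (x : Space N) : reflect e b (reflect e b x) = x := by
  conv_lhs => rw [reflect]
  rw [inner_reflect he, reflect]
  module

lemma norm_sub_reflect_sq (he : ‖e‖ = 1) (x y : Space N) :
    ‖x - reflect e b y‖ ^ 2 = ‖x - y‖ ^ 2 + 4 * (inner ℝ e x - b) * (inner ℝ e y - b) := by
  have h : x - reflect e b y = (x - y) + (2 * (inner ℝ e y - b)) • e := by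
    rw [reflect]; module
  rw [h, norm_add_sq_real, inner_smul_right, norm_smul, mul_pow, he, inner_sub_left,
    real_inner_comm e x, real_inner_comm e y, Real.norm_eq_abs, sq_abs]
  ring

lemma norm_reflect_sub (he : ‖e‖ = 1) (x y : Space N) :
    ‖reflect e b x - y‖ = ‖x - reflect e b y‖ := by
  rw [← sq_eq_sq₀ (norm_nonneg _) (norm_nonneg _), norm_sub_rev, norm_sub_reflect_sq he,
    norm_sub_reflect_sq he, norm_sub_rev]
  ring

lemma norm_reflect_sub_reflect (he : ‖e‖ = 1) (x y : Space N) :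
    ‖reflect e b x - reflect e b y‖ = ‖x - y‖ := by
  rw [norm_reflect_sub he, reflect_reflect he]

lemma continuous_reflect : Continuous (reflect e b) := by
  unfold reflect; fun_prop

lemma measurePreserving_reflect (he : ‖e‖ = 1) :
    MeasurePreserving (reflect e b) (volume : Measure (Space N)) volume := by
  have h1 := ((ℝ ∙ e)ᗮ.reflection).measurePreserving
  have h2 := measurePreserving_add_left (volume : Measure (Space N)) ((2 * b) • e)
  have h3 : reflect e b = (fun x => (2 * b) • e + x) ∘ (ℝ ∙ e)ᗮ.reflection := by
    funext x
    rw [Function.comp, Submodule.reflection_orthogonal_apply,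
      Submodule.reflection_singleton_apply, he, reflect]
    simp only [RCLike.ofReal_real_eq_id, id, one_pow, div_one]
    module
  rw [h3]
  exact h2.comp h1

lemma measurableEmbedding_reflect (he : ‖e‖ = 1) : MeasurableEmbedding (reflect e b) :=
  (MeasurableEquiv.ofInvolutive _ (reflect_reflect he)
    continuous_reflect.measurable).measurableEmbedding

/-- Distances from points of `B_ρ(x₀)` to the hyperplane, when `x₀` has distance at least `2 ρ`. -/
lemma lt_inner_of_mem_ball (he : ‖e‖ = 1) {ρ : ℝ} {x₀ x : Space N}
    (hx₀ : 2 * ρ ≤ inner ℝ e x₀ - b) (hx : x ∈ Metric.ball x₀ ρ) : ρ < inner ℝ e x - b := by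
  have h1 : inner ℝ e (x₀ - x) ≤ ‖e‖ * ‖x₀ - x‖ := real_inner_le_norm e _
  rw [Metric.mem_ball, dist_comm, dist_eq_norm] at hx
  rw [inner_sub_right, he] at h1
  linarith

lemma le_inner_of_le_infDist (he : ‖e‖ = 1) {d : ℝ} {x₀ : Space N} (hx₀ : x₀ ∈ halfSpace e b)
    (hd : d ≤ Metric.infDist x₀ (frontier (halfSpace e b))) : d ≤ inner ℝ e x₀ - b := by
  have hx₀' : b < inner ℝ e x₀ := hx₀
  have hee : inner ℝ e e = (1 : ℝ) := by rw [real_inner_self_eq_norm_sq, he]; norm_num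
  set y := x₀ - (inner ℝ e x₀ - b) • e with hy
  have hye : inner ℝ e y = b := by
    rw [hy, inner_sub_right, inner_smul_right, hee]; ring
  have hopen : IsOpen (halfSpace e b) := isOpen_lt continuous_const (by fun_prop)
  have hyf : y ∈ frontier (halfSpace e b) := by
    rw [hopen.frontier_eq]
    refine ⟨?_, fun h => ?_⟩
    -- the projection `y` of `x₀` is approached from inside along `e`
    · have ht : Tendsto (fun t : ℝ => y + t • e) (𝓝[>] 0) (𝓝 (y + (0 : ℝ) • e)) :=
        (Continuous.tendsto (by fun_prop) _).mono_left nhdsWithin_le_nhds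
      rw [zero_smul, add_zero] at ht
      refine mem_closure_of_tendsto ht ?_
      filter_upwards [self_mem_nhdsWithin] with t ht
      show b < inner ℝ e (y + t • e)
      rw [inner_add_right, inner_smul_right, hee, hye]
      linarith [Set.mem_Ioi.1 ht]
    · have : b < inner ℝ e y := h
      linarith
  have h1 := Metric.infDist_le_dist_of_mem (x := x₀) hyf
  have h2 : dist x₀ y = inner ℝ e x₀ - b := by
    rw [dist_eq_norm, hy, sub_sub_cancel, norm_smul, he, mul_one,
      Real.norm_of_nonneg (by linarith)]
  linarith

end Reflection

/-! ### Difference quotients and the energy form -/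

/-- The weighted difference quotient `(u x - u y) / ‖x - y‖^(N / 2 + s)`, whose `L²` norm is the
Gagliardo seminorm. -/
noncomputable def diffQuot {N : ℕ} (s : ℝ) (u : Space N → ℝ) (z : Space N × Space N) : ℝ :=
  (u z.1 - u z.2) / ‖z.1 - z.2‖ ^ ((N : ℝ) / 2 + s)

section Energy

variable {N : ℕ} {s : ℝ} {u v w φ : Space N → ℝ}

lemma div_norm_rpow_eq_mul_regKernel (a : ℝ) (z : Space N) :
    a / ‖z‖ ^ ((N : ℝ) + 2 * s) = a * regKernel ((N : ℝ) / 2 + s) 0 z := by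
  rw [regKernel, zero_add, ← Real.rpow_natCast ‖z‖ 2, ← Real.rpow_mul (norm_nonneg z),
    div_eq_mul_inv, ← Real.rpow_neg (norm_nonneg z)]
  congr 2
  push_cast; ring

lemma sq_norm_rpow (z : Space N) :
    (‖z‖ ^ ((N : ℝ) / 2 + s)) ^ 2 = ‖z‖ ^ ((N : ℝ) + 2 * s) := by
  rw [← Real.rpow_natCast (‖z‖ ^ ((N : ℝ) / 2 + s)) 2, ← Real.rpow_mul (norm_nonneg z)]
  congr 1
  push_cast; ring

lemma diffQuot_mul_diffQuot (z : Space N × Space N) : diffQuot s u z * diffQuot s φ z =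
    (u z.1 - u z.2) * (φ z.1 - φ z.2) * regKernel ((N : ℝ) / 2 + s) 0 (z.1 - z.2) := by
  rw [← div_norm_rpow_eq_mul_regKernel, ← sq_norm_rpow, diffQuot, diffQuot, div_mul_div_comm, sq]

lemma energy_eq : energy s u φ = fracConst N s / 2 * ∫ z : Space N × Space N,
    (u z.1 - u z.2) * (φ z.1 - φ z.2) * regKernel ((N : ℝ) / 2 + s) 0 (z.1 - z.2) := by
  simp only [energy, div_norm_rpow_eq_mul_regKernel]

lemma enorm_diffQuot_sq (z : Space N × Space N) : ‖diffQuot s u z‖ₑ ^ 2 =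
    ENNReal.ofReal (|u z.1 - u z.2| ^ 2 / ‖z.1 - z.2‖ ^ ((N : ℝ) + 2 * s)) := by
  rw [Real.enorm_eq_ofReal_abs, ← ENNReal.ofReal_pow (abs_nonneg _), sq_abs, diffQuot, div_pow,
    sq_norm_rpow, sq_abs]

lemma gagliardoSq_eq (A : Set (Space N)) :
    gagliardoSq s A u = ∫⁻ z in A ×ˢ A, ‖diffQuot s u z‖ₑ ^ 2 := by
  simp only [gagliardoSq, enorm_diffQuot_sq]

lemma aestronglyMeasurable_diffQuot (hu : AEStronglyMeasurable u) :
    AEStronglyMeasurable (diffQuot s u) := by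
  have h1 : AEStronglyMeasurable (fun z : Space N × Space N => u z.1 - u z.2) :=
    hu.comp_fst.sub hu.comp_snd
  have h2 : Measurable fun z : Space N × Space N => ‖z.1 - z.2‖ ^ ((N : ℝ) / 2 + s) := by fun_prop
  exact (h1.aemeasurable.div h2.aemeasurable).aestronglyMeasurable

lemma memHs_iff : MemHs s u ↔ MemLp u 2 ∧ MemLp (diffQuot s u) 2 := by
  unfold MemHs
  refine and_congr_right fun hu => ?_
  rw [gagliardoSq_eq, Set.univ_prod_univ, Measure.restrict_univ, MemLp,
    eLpNorm_lt_top_iff_lintegral_rpow_enorm_lt_top two_ne_zero ENNReal.ofNat_ne_top]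
  simp [aestronglyMeasurable_diffQuot hu.1]

lemma MemHs.of_abs_sub_le (hu : MemHs s u) (hv : MemHs s v) (hw : AEStronglyMeasurable w)
    (h0 : ∀ x, |w x| ≤ |u x| + |v x|)
    (h : ∀ x y, |w x - w y| ≤ |u x - u y| + |v x - v y|) : MemHs s w := by
  rw [memHs_iff] at *
  refine ⟨(hu.1.norm.add hv.1.norm).of_le hw (Eventually.of_forall fun x => ?_),
    (hu.2.norm.add hv.2.norm).of_le (aestronglyMeasurable_diffQuot hw)
      (Eventually.of_forall fun z => ?_)⟩
  · simpa using (h0 x).trans (le_abs_self _)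
  · refine le_trans ?_ (le_abs_self _)
    simp only [Pi.add_apply, diffQuot, norm_div, Real.norm_eq_abs]
    rw [← add_div]
    exact div_le_div_of_nonneg_right (h _ _) (abs_nonneg _)

lemma MemHs.sub (hu : MemHs s u) (hv : MemHs s v) : MemHs s fun x => u x - v x := by
  refine hu.of_abs_sub_le hv (hu.1.1.sub hv.1.1) (fun x => abs_sub _ _) fun x y => ?_
  refine le_trans (le_of_eq ?_) (abs_sub _ _)
  congr 1; ring

lemma MemHs.const_mul (hu : MemHs s u) (a : ℝ) : MemHs s fun x => a * u x := by
  rw [memHs_iff] at *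
  refine ⟨hu.1.const_mul a, (hu.2.const_mul a).congr_norm
    (aestronglyMeasurable_diffQuot (hu.1.1.const_mul a)) (Eventually.of_forall fun z => ?_)⟩
  simp only [diffQuot]
  congr 1; ring

lemma MemHs.comp_reflect {e : Space N} {b : ℝ} (he : ‖e‖ = 1) (hu : MemHs s u) :
    MemHs s fun x => u (reflect e b x) := by
  rw [memHs_iff] at *
  have hm := measurePreserving_reflect (b := b) he
  refine ⟨hu.1.comp_measurePreserving hm, ?_⟩
  have := hu.2.comp_measurePreserving (hm.prod hm)
  refine this.congr_norm (aestronglyMeasurable_diffQuot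
    (hu.1.1.comp_measurePreserving hm)) (Eventually.of_forall fun z => ?_)
  simp [diffQuot, Prod.map, norm_reflect_sub_reflect he]

lemma MemHs.integrable_energy (hu : MemHs s u) (hφ : MemHs s φ) :
    Integrable fun z : Space N × Space N =>
      (u z.1 - u z.2) * (φ z.1 - φ z.2) * regKernel ((N : ℝ) / 2 + s) 0 (z.1 - z.2) := by
  rw [memHs_iff] at *
  refine (hu.2.integrable_mul hφ.2).congr (Eventually.of_forall fun z => ?_)
  exact diffQuot_mul_diffQuot z

lemma energy_sub (hu : MemHs s u) (hv : MemHs s v) (hφ : MemHs s φ) :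
    energy s (fun x => u x - v x) φ = energy s u φ - energy s v φ := by
  rw [energy_eq, energy_eq, energy_eq, ← mul_sub,
    ← integral_sub (hu.integrable_energy hφ) (hv.integrable_energy hφ)]
  congr 1
  exact integral_congr_ae (Eventually.of_forall fun z => by simp only; ring)

lemma energy_const_mul (a : ℝ) : energy s (fun x => a * u x) φ = a * energy s u φ := by
  rw [energy_eq, energy_eq, mul_left_comm, ← integral_const_mul a]
  congr 1
  exact integral_congr_ae (Eventually.of_forall fun z => by simp only; ring)

lemma fracConst_pos (N : ℕ) (hs0 : 0 < s) (hs1 : s < 1) : 0 < fracConst N s := by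
  have h1 : 0 < 1 - s := by linarith
  have h2 : 0 < Real.Gamma ((N : ℝ) / 2 + s) := Real.Gamma_pos_of_pos (by positivity)
  have h3 : 0 < Real.Gamma (2 - s) := Real.Gamma_pos_of_pos (by linarith)
  have h4 := Real.pi_pos
  unfold fracConst
  positivity

lemma integrable_fst_mul_regKernel {p ε : ℝ} (hp : (N : ℝ) / 2 < p) (hε : 0 < ε)
    (hφ : Integrable φ) :
    Integrable fun z : Space N × Space N => φ z.1 * regKernel p ε (z.1 - z.2) := by
  have h1 := hφ.mul_prod (integrable_regKernel (N := N) hp hε)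
  have h2 := (measurePreserving_prod_sub (volume : Measure (Space N)) volume)
    |>.integrable_comp_of_integrable h1
  refine h2.congr (Eventually.of_forall fun z => ?_)
  simp only [Function.comp]
  rw [regKernel_sub_comm]

lemma integrable_mul_sub_mul_regKernel {p ε M : ℝ} (hp : (N : ℝ) / 2 < p) (hε : 0 < ε)
    (hu : Measurable u) (hM : ∀ x y, |u x - u y| ≤ M) (hφ : Integrable φ) :
    Integrable fun z : Space N × Space N =>
      φ z.1 * ((u z.1 - u z.2) * regKernel p ε (z.1 - z.2)) := by
  have hK := measurable_regKernel (N := N) (p := p) (ε := ε)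
  refine ((integrable_fst_mul_regKernel hp hε hφ).norm.const_mul M).mono'
    (hφ.1.comp_fst.mul (Measurable.aestronglyMeasurable (by fun_prop)))
    (Eventually.of_forall fun z => ?_)
  simp only [norm_mul]
  have := mul_le_mul_of_nonneg_right (hM z.1 z.2)
    (mul_nonneg (norm_nonneg (φ z.1)) (norm_nonneg (regKernel p ε (z.1 - z.2))))
  simp only [Real.norm_eq_abs] at this ⊢
  linarith

lemma integral_mul_sub_mul_regKernel {p ε : ℝ} (x : Space N) :
    ∫ y, φ x * ((u x - u y) * regKernel p ε (x - y)) = φ x * regLap p ε u x := by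
  rw [integral_const_mul, regLap, ← integral_add_left_eq_self _ x]
  simp only [sub_add_cancel_left, regKernel_neg]

lemma integrable_mul_regLap {p ε M : ℝ} (hp : (N : ℝ) / 2 < p) (hε : 0 < ε)
    (hu : Measurable u) (hM : ∀ x y, |u x - u y| ≤ M) (hφ : Integrable φ) :
    Integrable fun x => φ x * regLap p ε u x :=
  (integrable_mul_sub_mul_regKernel hp hε hu hM hφ).integral_prod_left.congr
    (Eventually.of_forall integral_mul_sub_mul_regKernel)

/-- The regularized energy form, tested with an integrable function. -/
lemma integral_regularized_energy {p ε M : ℝ} (hp : (N : ℝ) / 2 < p) (hε : 0 < ε)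
    (hu : Measurable u) (hM : ∀ x y, |u x - u y| ≤ M) (hφ : Integrable φ) :
    ∫ z : Space N × Space N, (u z.1 - u z.2) * (φ z.1 - φ z.2) * regKernel p ε (z.1 - z.2) =
      2 * ∫ x, φ x * regLap p ε u x := by
  have hGi := integrable_mul_sub_mul_regKernel hp hε hu hM hφ
  set G : Space N × Space N → ℝ :=
    fun z => φ z.1 * ((u z.1 - u z.2) * regKernel p ε (z.1 - z.2)) with hG
  have h1 : ∫ z, G z = ∫ x, φ x * regLap p ε u x := by
    rw [Measure.volume_eq_prod, integral_prod G hGi]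
    exact integral_congr_ae (Eventually.of_forall integral_mul_sub_mul_regKernel)
  have h2 : ∫ z : Space N × Space N, G z.swap = ∫ z, G z := by
    rw [Measure.volume_eq_prod]; exact integral_prod_swap G
  have hGi2 : Integrable fun z : Space N × Space N => G z.swap := hGi.swap
  rw [two_mul, ← h1]
  nth_rewrite 2 [← h2]
  rw [← integral_add hGi hGi2]
  refine integral_congr_ae (Eventually.of_forall fun z => ?_)
  simp only [hG, Prod.fst_swap, Prod.snd_swap]
  rw [regKernel_sub_comm z.2 z.1]
  ring

lemma tendsto_regKernel {p : ℝ} {z : Space N} (hz : z ≠ 0) :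
    Tendsto (fun ε => regKernel p ε z) (𝓝[>] 0) (𝓝 (regKernel p 0 z)) := by
  refine Tendsto.mono_left ?_ nhdsWithin_le_nhds
  have h : 0 + ‖z‖ ^ 2 ≠ 0 := by simpa using hz
  exact ((continuous_id.add continuous_const).continuousAt (x := (0 : ℝ))).rpow_const
    (Or.inl h)

end Energy

/-! ### The energy of an antisymmetrized bump -/

section BumpEnergy

variable {N : ℕ} {s A ρ : ℝ} {x₀ : Space N} {u φ : Space N → ℝ} {e : Space N} {b : ℝ}

/-- The regularized energies of a bump are bounded by the mean value inequality, hence so is the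
Gagliardo seminorm. -/
lemma IsBump.memHs (hu : IsBump (N / 2 + s) A ρ x₀ u) (hA : 0 ≤ A) (hs0 : 0 < s) (hs1 : s < 1) :
    MemHs s u := by
  set p : ℝ := N / 2 + s with hp
  have hpN : (N : ℝ) / 2 < p := by linarith
  have hui := hu.integrable
  have hum := hu.measurable
  have hK := integrable_regKernel (N := N) hpN one_pos
  set I := ∫ z : Space N, regKernel p 1 z with hI
  set C := I + p * A / (1 - s) * 1 ^ (1 - s) with hC
  have hbound : ∀ ε > 0, ε ≤ 1 → ∀ x, regLap p ε u x ≤ C := by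
    intro ε hε hε1 x
    refine (hu.regLap_le hA hs0 hs1 x hε hε1).trans (add_le_add ?_ le_rfl)
    have := hu.integrable_sub_mul x hK (r := 1)
    simp only [one_smul] at this
    refine integral_mono this hK fun z => ?_
    exact mul_le_of_le_one_left (regKernel_nonneg zero_le_one z)
      ((le_abs_self _).trans (hu.abs_sub_le _ _))
  set F : ℝ → Space N × Space N → ℝ :=
    fun ε z => (u z.1 - u z.2) * (u z.1 - u z.2) * regKernel p ε (z.1 - z.2) with hF
  have hFm : ∀ ε, Measurable (F ε) := fun ε => by
    have := measurable_regKernel (N := N) (p := p) (ε := ε)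
    fun_prop
  have hF0 : ∀ ε, 0 ≤ ε → ∀ z, 0 ≤ F ε z := fun ε hε z =>
    mul_nonneg (mul_self_nonneg _) (regKernel_nonneg hε _)
  have hFint : ∀ ε > 0, ε ≤ 1 →
      ∫⁻ z, ENNReal.ofReal (F ε z) ≤ ENNReal.ofReal (2 * (C * ∫ x, u x)) := by
    intro ε hε hε1
    have hFi : Integrable (F ε) := by
      have h1 := integrable_fst_mul_regKernel (N := N) hpN hε hui
      have h2 : Integrable fun z : Space N × Space N => u z.2 * regKernel p ε (z.1 - z.2) := by
        refine h1.swap.congr (Eventually.of_forall fun z => ?_)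
        simp only [Function.comp, Prod.fst_swap, Prod.snd_swap]
        rw [regKernel_sub_comm]
      refine (h1.add h2).mono' (hFm ε).aestronglyMeasurable (Eventually.of_forall fun z => ?_)
      rw [Real.norm_of_nonneg (hF0 ε hε.le z), Pi.add_apply, ← add_mul]
      refine mul_le_mul_of_nonneg_right ?_ (regKernel_nonneg hε.le _)
      nlinarith [hu.nonneg z.1, hu.nonneg z.2, hu.le_one z.1, hu.le_one z.2,
        mul_nonneg (hu.nonneg z.1) (hu.nonneg z.2)]
    rw [← ofReal_integral_eq_lintegral_ofReal hFi (Eventually.of_forall (hF0 ε hε.le))]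
    refine ENNReal.ofReal_le_ofReal ?_
    rw [hF, integral_regularized_energy hpN hε hum hu.abs_sub_le hui]
    refine mul_le_mul_of_nonneg_left ?_ zero_le_two
    rw [← integral_const_mul]
    refine integral_mono (integrable_mul_regLap hpN hε hum hu.abs_sub_le hui) (hui.const_mul C)
      fun x => ?_
    simp only
    rw [mul_comm]
    exact mul_le_mul_of_nonneg_right (hbound ε hε hε1 x) (hu.nonneg x)
  have hlim : ∀ z, Tendsto (fun n : ℕ => ENNReal.ofReal (F (1 / ((n : ℝ) + 1)) z)) atTop
      (𝓝 (ENNReal.ofReal (F 0 z))) := by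
    intro z
    refine (ENNReal.continuous_ofReal.tendsto _).comp ?_
    by_cases hz : z.1 = z.2
    · simp [hF, hz]
    · have h1 := (tendsto_regKernel (p := p) (sub_ne_zero.2 hz)).const_mul
        ((u z.1 - u z.2) * (u z.1 - u z.2))
      refine h1.comp (tendsto_nhdsWithin_iff.2 ⟨tendsto_one_div_add_atTop_nhds_zero_nat, ?_⟩)
      exact Eventually.of_forall fun n => Set.mem_Ioi.2 (by positivity)
  refine ⟨?_, ?_⟩
  · refine (memLp_two_iff_integrable_sq hum.aestronglyMeasurable).2 ?_
    refine hui.mono' (hum.pow_const 2).aestronglyMeasurable (Eventually.of_forall fun x => ?_)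
    rw [Real.norm_of_nonneg (sq_nonneg _)]
    nlinarith [hu.nonneg x, hu.le_one x]
  -- Fatou's lemma along `ε = 1 / (n + 1)`
  · calc gagliardoSq s Set.univ u = ∫⁻ z, ENNReal.ofReal (F 0 z) := by
          rw [gagliardoSq, Set.univ_prod_univ, Measure.restrict_univ]
          refine lintegral_congr fun z => ?_
          rw [div_norm_rpow_eq_mul_regKernel, sq_abs, sq]
      _ = ∫⁻ z, liminf (fun n : ℕ => ENNReal.ofReal (F (1 / ((n : ℝ) + 1)) z)) atTop :=
          lintegral_congr fun z => (hlim z).liminf_eq.symm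
      _ ≤ liminf (fun n : ℕ => ∫⁻ z, ENNReal.ofReal (F (1 / ((n : ℝ) + 1)) z)) atTop :=
          lintegral_liminf_le fun n => (hFm _).ennreal_ofReal
      _ ≤ ENNReal.ofReal (2 * (C * ∫ x, u x)) := by
          refine liminf_le_of_frequently_le' (Eventually.of_forall fun n => ?_).frequently
          refine hFint _ (by positivity) ?_
          rw [div_le_one (by positivity)]
          linarith [(Nat.cast_nonneg n : (0 : ℝ) ≤ n)]
      _ < ∞ := ENNReal.ofReal_lt_top

/-- The kernel at distance `x - y` exceeds the one at the reflected distance by a fixed amount. -/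
lemma exists_le_regKernel_sub_regKernel {p : ℝ} (hp : 0 < p) (hρ : 0 < ρ) :
    ∃ a > (0 : ℝ), ∀ δ ε, 0 < δ → δ ≤ 2 * ρ ^ 2 → 0 ≤ ε → ∀ z z' : Space N,
      ‖z‖ ≤ 2 * ρ → ‖z‖ ^ 2 + 4 * ρ ^ 2 ≤ ‖z'‖ ^ 2 → a ≤ regKernel p δ z - regKernel p ε z' := by
  refine ⟨(1 - (4 / 3 : ℝ) ^ (-p)) * (6 * ρ ^ 2) ^ (-p), ?_, fun δ ε hδ hδρ hε z z' hz hz' => ?_⟩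
  · have : (4 / 3 : ℝ) ^ (-p) < 1 := Real.rpow_lt_one_of_one_lt_of_neg (by norm_num) (by linarith)
    have h1 : 0 < 1 - (4 / 3 : ℝ) ^ (-p) := by linarith
    positivity
  -- for `‖z‖² ≤ 4 ρ²` one has `2 ρ² + ‖z‖² ≤ 6 ρ²` and `4 ρ² + ‖z‖² ≥ (4 / 3) (2 ρ² + ‖z‖²)`
  have hle1 : (4 / 3 : ℝ) ^ (-p) < 1 :=
    Real.rpow_lt_one_of_one_lt_of_neg (by norm_num) (by linarith)
  have hz2 : ‖z‖ ^ 2 ≤ 4 * ρ ^ 2 := by nlinarith [norm_nonneg z]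
  have h1 : (2 * ρ ^ 2 + ‖z‖ ^ 2) ^ (-p) ≤ regKernel p δ z :=
    Real.rpow_le_rpow_of_nonpos (by positivity) (by linarith) (by linarith)
  have h2 : regKernel p ε z' ≤ (4 / 3 : ℝ) ^ (-p) * (2 * ρ ^ 2 + ‖z‖ ^ 2) ^ (-p) := by
    rw [← Real.mul_rpow (by norm_num) (by positivity)]
    exact Real.rpow_le_rpow_of_nonpos (by positivity) (by linarith) (by linarith)
  have h3 : (6 * ρ ^ 2) ^ (-p) ≤ (2 * ρ ^ 2 + ‖z‖ ^ 2) ^ (-p) :=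
    Real.rpow_le_rpow_of_nonpos (by positivity) (by linarith) (by linarith)
  have h4 := mul_le_mul_of_nonneg_left h3 (show 0 ≤ 1 - (4 / 3 : ℝ) ^ (-p) by linarith)
  linarith

/-- The fractional Laplacian of an antisymmetrized bump is at most `C u - a` on the support of the
bump, with `a > 0`: the small scales contribute little by the mean value inequality, while on the
large scales `-∫ u(y) (k(x - y) - k(x - Q y)) dy` is bounded above by a negative constant. -/
lemma exists_regLap_antisymm_le (hs0 : 0 < s) (hs1 : s < 1) (hρ : 0 < ρ) (hA : 0 ≤ A) {m : ℝ}
    (hm : 0 < m) :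
    ∃ C ≥ (0 : ℝ), ∃ a > (0 : ℝ), ∃ δ > (0 : ℝ), ∀ (e : Space N) (b : ℝ), ‖e‖ = 1 →
      ∀ x₀, 2 * ρ ≤ inner ℝ e x₀ - b → ∀ u, IsBump (N / 2 + s) A ρ x₀ u → m ≤ ∫ x, u x →
      ∀ ε, 0 < ε → ε ≤ δ → ∀ x ∈ Metric.ball x₀ ρ,
        regLap (N / 2 + s) ε (fun y => u y - u (reflect e b y)) x ≤ C * u x - a := by
  set p : ℝ := N / 2 + s with hp
  have hpN : (N : ℝ) / 2 < p := by linarith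
  have hp0 : 0 < p := by positivity
  obtain ⟨a, ha, hker⟩ := exists_le_regKernel_sub_regKernel (N := N) hp0 hρ
  obtain ⟨δ, hδ, hδρ, hδa⟩ : ∃ δ > 0, δ ≤ 2 * ρ ^ 2 ∧
      p * A / (1 - s) * δ ^ (1 - s) < a * m / 2 := by
    have h1 : Tendsto (fun δ : ℝ => p * A / (1 - s) * δ ^ (1 - s)) (𝓝[>] 0)
        (𝓝 (p * A / (1 - s) * 0 ^ (1 - s))) :=
      ((Real.continuousAt_rpow_const 0 (1 - s) (Or.inr (by linarith))).tendsto.const_mul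
        _).mono_left nhdsWithin_le_nhds
    rw [Real.zero_rpow (by linarith), mul_zero] at h1
    obtain ⟨δ, ⟨h2, h3⟩, h4⟩ := ((h1.eventually
      (gt_mem_nhds (show 0 < a * m / 2 by positivity))).and (Ioo_mem_nhdsGT
        (show 0 < 2 * ρ ^ 2 by positivity))).and self_mem_nhdsWithin |>.exists
    exact ⟨δ, h4, h3.2.le, h2⟩
  have hKδ := integrable_regKernel (N := N) hpN hδ
  refine ⟨∫ z : Space N, regKernel p δ z, integral_nonneg fun z => regKernel_nonneg hδ.le z,
    a * m / 2, by positivity, δ, hδ, fun e b he x₀ hx₀ u hu hmu ε hε hεδ x hx => ?_⟩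
  have hKε := integrable_regKernel (N := N) hpN hε
  have hum := hu.measurable
  have hQm : Measurable (reflect e b) := continuous_reflect.measurable
  have hux : u (reflect e b x) = 0 := by
    refine hu.eq_zero _ fun h => ?_
    have h1 := lt_inner_of_mem_ball he hx₀ hx
    have h2 := lt_inner_of_mem_ball he hx₀ h
    rw [inner_reflect he] at h2
    linarith
  have hi1 : ∀ η > 0, Integrable fun z => (u x - u (x + z)) * regKernel p η z := fun η hη => by
    simpa using hu.integrable_sub_mul x (integrable_regKernel (N := N) hpN hη) (r := 1)
  have hbd : ∀ (g : Space N → Space N), Measurable g → ∀ K : Space N → ℝ, Integrable K →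
      Integrable fun z => u (g z) * K z := fun g hg K hK => by
    refine hK.norm.mono' ((hum.comp hg).aestronglyMeasurable.mul hK.1)
      (Eventually.of_forall fun z => ?_)
    rw [norm_mul, Real.norm_of_nonneg (hu.nonneg _)]
    exact mul_le_of_le_one_left (norm_nonneg _) (hu.le_one _)
  have hQ := measurePreserving_reflect (b := b) he
  have hKεx : Integrable fun y => regKernel p ε (y - x) := hKε.comp_sub_right x
  have hKδx : Integrable fun y => regKernel p δ (y - x) := hKδ.comp_sub_right x
  have hKQ : Integrable fun y => regKernel p ε (reflect e b y - x) :=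
    hQ.integrable_comp_of_integrable hKεx
  -- the reflected part of the function
  have e1 : regLap p ε (fun y => u y - u (reflect e b y)) x =
      regLap p ε u x + ∫ y, u y * regKernel p ε (reflect e b y - x) := by
    have h1 : ∫ y, u y * regKernel p ε (reflect e b y - x) =
        ∫ z, u (reflect e b (x + z)) * regKernel p ε z := by
      rw [← hQ.integral_comp (measurableEmbedding_reflect he), ← integral_add_left_eq_self _ x]
      simp only [reflect_reflect he, add_sub_cancel_left]
    rw [h1, regLap, regLap, ← integral_add (hi1 ε hε) (hbd _ (by fun_prop) _ hKε)]
    refine integral_congr_ae (Eventually.of_forall fun z => ?_)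
    simp only [hux]
    ring
  have e2 : regLap p δ u x = (∫ z : Space N, regKernel p δ z) * u x -
      ∫ y, u y * regKernel p δ (y - x) := by
    have h1 : ∫ y, u y * regKernel p δ (y - x) = ∫ z, u (x + z) * regKernel p δ z := by
      rw [← integral_add_left_eq_self _ x]
      simp only [add_sub_cancel_left]
    rw [h1, regLap, mul_comm, ← integral_const_mul,
      ← integral_sub (hKδ.const_mul _) (hbd _ (by fun_prop) _ hKδ)]
    refine integral_congr_ae (Eventually.of_forall fun z => ?_)
    simp only
    ring
  have e3 : a * m ≤ (∫ y, u y * regKernel p δ (y - x)) -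
      ∫ y, u y * regKernel p ε (reflect e b y - x) := by
    have i1 := hbd _ measurable_id _ hKδx
    have i2 := hbd _ measurable_id _ hKQ
    simp only [id] at i1 i2
    calc a * m ≤ a * ∫ y, u y := mul_le_mul_of_nonneg_left hmu ha.le
      _ = ∫ y, a * u y := (integral_const_mul _ _).symm
      _ ≤ ∫ y, (u y * regKernel p δ (y - x) - u y * regKernel p ε (reflect e b y - x)) := by
          refine integral_mono (hu.integrable.const_mul a) (i1.sub i2) fun y => ?_
          simp only
          by_cases hy : y ∈ Metric.ball x₀ ρ
          · rw [← mul_sub, mul_comm]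
            refine mul_le_mul_of_nonneg_left (hker δ ε hδ hδρ hε.le _ _ ?_ ?_) (hu.nonneg y)
            · rw [← dist_eq_norm]
              have := dist_triangle_right y x x₀
              linarith [Metric.mem_ball.1 hx, Metric.mem_ball.1 hy]
            · rw [norm_reflect_sub he, norm_sub_reflect_sq he]
              have h1 := lt_inner_of_mem_ball he hx₀ hx
              have h2 := lt_inner_of_mem_ball he hx₀ hy
              nlinarith
          · simp [hu.eq_zero y hy]
      _ = _ := integral_sub i1 i2
  have := hu.regLap_le hA hs0 hs1 x hε hεδ
  linarith

end BumpEnergy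

section AntisymmetricEnergy

variable {N : ℕ} {s A ρ : ℝ} {x₀ : Space N} {u w φ : Space N → ℝ} {e : Space N} {b : ℝ}

lemma IsBump.memHs_antisymm (hu : IsBump (N / 2 + s) A ρ x₀ u) (hA : 0 ≤ A) (hs0 : 0 < s)
    (hs1 : s < 1) (he : ‖e‖ = 1) : MemHs s fun x => u x - u (reflect e b x) :=
  (hu.memHs hA hs0 hs1).sub ((hu.memHs hA hs0 hs1).comp_reflect he)

/-- The energy is the limit of the regularized energies. -/
lemma tendsto_regularized_energy (hs0 : 0 < s) (hw : MemHs s w) (hφ : MemHs s φ) :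
    Tendsto (fun ε => ∫ z : Space N × Space N,
        (w z.1 - w z.2) * (φ z.1 - φ z.2) * regKernel ((N : ℝ) / 2 + s) ε (z.1 - z.2)) (𝓝[>] 0)
      (𝓝 (∫ z : Space N × Space N,
        (w z.1 - w z.2) * (φ z.1 - φ z.2) * regKernel ((N : ℝ) / 2 + s) 0 (z.1 - z.2))) := by
  have hp0 : 0 ≤ (N : ℝ) / 2 + s := by positivity
  refine tendsto_integral_filter_of_dominated_convergence _ ?_ ?_
    (hw.integrable_energy hφ).norm ?_
  · refine Eventually.of_forall fun ε => ?_
    have hK := measurable_regKernel (N := N) (p := (N : ℝ) / 2 + s) (ε := ε)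
    exact ((hw.1.1.comp_fst.sub hw.1.1.comp_snd).mul (hφ.1.1.comp_fst.sub hφ.1.1.comp_snd)).mul
      (Measurable.aestronglyMeasurable (by fun_prop))
  · filter_upwards [self_mem_nhdsWithin] with ε hε
    have hε : 0 < ε := hε
    refine Eventually.of_forall fun z => ?_
    rw [norm_mul, norm_mul _ (regKernel _ 0 _), Real.norm_of_nonneg (regKernel_nonneg hε.le _),
      Real.norm_of_nonneg (regKernel_nonneg le_rfl _)]
    by_cases hz : z.1 = z.2
    · simp [hz]
    · exact mul_le_mul_of_nonneg_left
        (regKernel_anti hp0 le_rfl hε.le (sub_ne_zero.2 hz)) (norm_nonneg _)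
  · refine Eventually.of_forall fun z => ?_
    by_cases hz : z.1 = z.2
    · simp [hz]
    · exact (tendsto_regKernel (sub_ne_zero.2 hz)).const_mul _

/-- In the weak sense, the fractional Laplacian of an antisymmetrized bump is at most a multiple of
`C u - a` on the support of the bump. -/
lemma exists_energy_antisymm_le (hs0 : 0 < s) (hs1 : s < 1) (hρ : 0 < ρ) (hA : 0 ≤ A) {m : ℝ}
    (hm : 0 < m) :
    ∃ C ≥ (0 : ℝ), ∃ a > (0 : ℝ), ∀ (e : Space N) (b : ℝ), ‖e‖ = 1 →
      ∀ x₀, 2 * ρ ≤ inner ℝ e x₀ - b → ∀ u, IsBump (N / 2 + s) A ρ x₀ u → m ≤ ∫ x, u x →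
      ∀ φ : Space N → ℝ, MemHs s φ → Integrable φ → (∀ x, 0 ≤ φ x) →
        (∀ x ∉ Metric.ball x₀ ρ, φ x = 0) →
        energy s (fun x => u x - u (reflect e b x)) φ ≤
          fracConst N s * (C * (∫ x, u x * φ x) - a * ∫ x, φ x) := by
  obtain ⟨C, hC, a, ha, δ, hδ, H⟩ := exists_regLap_antisymm_le (N := N) hs0 hs1 hρ hA hm
  refine ⟨C, hC, a, ha, fun e b he x₀ hx₀ u hu hmu φ hφ hφi hφ0 hφB => ?_⟩
  have hpN : (N : ℝ) / 2 < (N : ℝ) / 2 + s := by linarith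
  set w : Space N → ℝ := fun x => u x - u (reflect e b x) with hw
  have hum := hu.measurable
  have hQm : Measurable (reflect e b) := continuous_reflect.measurable
  have hwm : Measurable w := by fun_prop
  have hwM : ∀ x y, |w x - w y| ≤ 2 := fun x y => by
    have h1 := abs_le.1 (hu.abs_sub_le x y)
    have h2 := abs_le.1 (hu.abs_sub_le (reflect e b x) (reflect e b y))
    rw [abs_le]
    simp only [hw]
    constructor <;> linarith
  have huφ : Integrable fun x => u x * φ x := by
    refine hφi.norm.mono' (hum.aestronglyMeasurable.mul hφi.1) (Eventually.of_forall fun x => ?_)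
    rw [norm_mul, Real.norm_of_nonneg (hu.nonneg x)]
    exact mul_le_of_le_one_left (norm_nonneg _) (hu.le_one x)
  have hlim := tendsto_regularized_energy hs0 (hu.memHs_antisymm (b := b) hA hs0 hs1 he) hφ
  have hle := le_of_tendsto hlim (b := 2 * (C * (∫ x, u x * φ x) - a * ∫ x, φ x)) (by
    filter_upwards [Ioc_mem_nhdsGT hδ] with ε hε
    rw [integral_regularized_energy hpN hε.1 hwm hwM hφi, ← integral_const_mul C,
      ← integral_const_mul a, ← integral_sub (huφ.const_mul C) (hφi.const_mul a)]
    refine mul_le_mul_of_nonneg_left (integral_mono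
      (integrable_mul_regLap hpN hε.1 hwm hwM hφi) ((huφ.const_mul C).sub (hφi.const_mul a))
      fun x => ?_) zero_le_two
    simp only
    by_cases hx : x ∈ Metric.ball x₀ ρ
    · have := mul_le_mul_of_nonneg_left (H e b he x₀ hx₀ u hu hmu ε hε.1 hε.2 x hx) (hφ0 x)
      linarith
    · simp [hφB x hx])
  rw [energy_eq]
  have hf := fracConst_pos N hs0 hs1
  calc _ ≤ fracConst N s / 2 * (2 * (C * (∫ x, u x * φ x) - a * ∫ x, φ x)) :=
        mul_le_mul_of_nonneg_left hle (by positivity)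
    _ = _ := by ring

/-! ### Testing an antisymmetric function with its negative part -/

/-- The algebraic inequality behind the maximum principle for antisymmetric functions: `a` and `a'`
are the values of the test function, which is the negative part of `w` up to an error `η`. -/
lemma antisymm_test_le {wx wy a a' ηx ηy k k' : ℝ} (ha : 0 ≤ a) (ha' : 0 ≤ a') (hηx : 0 ≤ ηx)
    (hηy : 0 ≤ ηy) (hk' : 0 ≤ k') (hk : k' ≤ k) (hx : wx * a = -a ^ 2) (hy : wy * a' = -a' ^ 2)
    (hwx : -a - ηx ≤ wx) (hwy : -a' - ηy ≤ wy) :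
    (wx - wy) * (a - a') * k + (wx + wy) * (a + a') * k' ≤ (a * ηy + a' * ηx) * k := by
  have h1 : 0 ≤ (wx * a' + wy * a + 2 * a * a' + ηx * a' + ηy * a) * (k - k') := by
    refine mul_nonneg ?_ (by linarith)
    have := mul_le_mul_of_nonneg_right hwx ha'
    have := mul_le_mul_of_nonneg_right hwy ha
    linarith
  have h2 : 0 ≤ (a - a') ^ 2 * (k - k') := mul_nonneg (sq_nonneg _) (by linarith)
  have h3 : 0 ≤ (ηx * a' + ηy * a) * k' := by positivity
  have h4 : 0 ≤ (a ^ 2 + a' ^ 2) * k' := by positivity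
  have e1 : (wx - wy) * (a - a') * k + (wx + wy) * (a + a') * k' =
      (wx * a + wy * a') * (k + k') - (wx * a' + wy * a) * (k - k') := by ring
  rw [e1, hx, hy]
  nlinarith

lemma integral_sum_reflect (he : ‖e‖ = 1) (f : Space N × Space N → ℝ) (hf : Integrable f) :
    Integrable (fun z => f z + f (reflect e b z.1, z.2) + f (z.1, reflect e b z.2) +
      f (reflect e b z.1, reflect e b z.2)) ∧
    ∫ z, (f z + f (reflect e b z.1, z.2) + f (z.1, reflect e b z.2) +
      f (reflect e b z.1, reflect e b z.2)) = 4 * ∫ z, f z := by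
  have hQmp := measurePreserving_reflect (b := b) he
  have hQme := measurableEmbedding_reflect (b := b) he
  have hid := MeasurePreserving.id (volume : Measure (Space N))
  have hide : MeasurableEmbedding (id : Space N → Space N) := MeasurableEmbedding.id
  have m1 := hQmp.prod hid
  have m2 := hid.prod hQmp
  have m3 := hQmp.prod hQmp
  have j1 : Integrable fun z : Space N × Space N => f (reflect e b z.1, z.2) :=
    m1.integrable_comp_of_integrable hf
  have j2 : Integrable fun z : Space N × Space N => f (z.1, reflect e b z.2) :=
    m2.integrable_comp_of_integrable hf
  have j3 : Integrable fun z : Space N × Space N => f (reflect e b z.1, reflect e b z.2) :=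
    m3.integrable_comp_of_integrable hf
  have k1 : ∫ z : Space N × Space N, f (reflect e b z.1, z.2) = ∫ z, f z :=
    m1.integral_comp (hQme.prodMap hide) f
  have k2 : ∫ z : Space N × Space N, f (z.1, reflect e b z.2) = ∫ z, f z :=
    m2.integral_comp (hide.prodMap hQme) f
  have k3 : ∫ z : Space N × Space N, f (reflect e b z.1, reflect e b z.2) = ∫ z, f z :=
    m3.integral_comp (hQme.prodMap hQme) f
  have j01 : Integrable fun z => f z + f (reflect e b z.1, z.2) := hf.add j1
  have j012 : Integrable fun z => f z + f (reflect e b z.1, z.2) + f (z.1, reflect e b z.2) :=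
    j01.add j2
  refine ⟨j012.add j3, ?_⟩
  rw [integral_add j012 j3, integral_add j01 j2, integral_add hf j1, k1, k2, k3]
  ring

/-- Let `w` be antisymmetric and let `φ`, supported in `B_ρ(x₀)`, be its negative part there. If
`w ≥ 0` on the rest of `B_{2ρ}(x₀)` and `w ≥ -σ` on the rest of the half space, then the energy of
`w` against `φ` is at most a multiple of `σ ∫ φ`. The integral is averaged over the reflections of
the two variables, which reduces the estimate to both variables in the half space. -/
lemma energy_negPart_le (hs0 : 0 < s) (hs1 : s < 1) (hρ : 0 < ρ) (he : ‖e‖ = 1)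
    (hx₀ : 2 * ρ ≤ inner ℝ e x₀ - b) (hw : MemHs s w) (hwa : Antisymmetric e b w)
    (hφ : MemHs s φ) (hφi : Integrable φ) (hφ0 : ∀ x, 0 ≤ φ x)
    (hφB : ∀ x ∉ Metric.ball x₀ ρ, φ x = 0) {σ : ℝ} (hσ : 0 ≤ σ)
    (h : ∀ᵐ x, x ∈ halfSpace e b → w x * φ x = -φ x ^ 2 ∧
      (x ∈ Metric.ball x₀ (2 * ρ) → -φ x ≤ w x) ∧ (x ∉ Metric.ball x₀ (2 * ρ) → -σ ≤ w x)) :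
    energy s w φ ≤ fracConst N s * ((ρ ^ 2 / (1 + ρ ^ 2)) ^ (-((N : ℝ) / 2 + s)) *
      (∫ z : Space N, regKernel ((N : ℝ) / 2 + s) 1 z) * σ * ∫ x, φ x) := by
  set p : ℝ := N / 2 + s with hp
  have hp0 : 0 < p := by positivity
  have hpN : (N : ℝ) / 2 < p := by linarith
  set c₀ : ℝ := (ρ ^ 2 / (1 + ρ ^ 2)) ^ (-p) with hc₀
  have hc₀0 : 0 ≤ c₀ := by positivity
  set Q := reflect e b with hQ
  have hQQ : ∀ x, Q (Q x) = x := reflect_reflect he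
  set F : Space N × Space N → ℝ :=
    fun z => (w z.1 - w z.2) * (φ z.1 - φ z.2) * regKernel p 0 (z.1 - z.2) with hF
  set B : Space N × Space N → ℝ :=
    fun z => σ * c₀ * ((φ z.1 + φ z.2) * regKernel p 1 (z.1 - z.2)) with hB
  have hFi : Integrable F := hw.integrable_energy hφ
  have hφ1 := integrable_fst_mul_regKernel (N := N) hpN one_pos hφi
  have hφ2 : Integrable fun z : Space N × Space N => φ z.2 * regKernel p 1 (z.1 - z.2) := by
    refine hφ1.swap.congr (Eventually.of_forall fun z => ?_)
    simp only [Function.comp, Prod.fst_swap, Prod.snd_swap]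
    rw [regKernel_sub_comm]
  have hBi : Integrable B := by
    refine ((hφ1.add hφ2).const_mul (σ * c₀)).congr (Eventually.of_forall fun z => ?_)
    simp only [hB, Pi.add_apply]; ring
  have hB0 : ∀ z, 0 ≤ B z := fun z => mul_nonneg (mul_nonneg hσ hc₀0)
    (mul_nonneg (add_nonneg (hφ0 _) (hφ0 _)) (regKernel_nonneg zero_le_one _))
  have hBint : ∫ z, B z = 2 * (c₀ * (∫ z : Space N, regKernel p 1 z) * σ * ∫ x, φ x) := by
    have i1 : ∫ z : Space N × Space N, φ z.1 * regKernel p 1 (z.1 - z.2) =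
        (∫ x, φ x) * ∫ z : Space N, regKernel p 1 z := by
      rw [Measure.volume_eq_prod, integral_prod _ hφ1, ← integral_mul_const]
      refine integral_congr_ae (Eventually.of_forall fun x => ?_)
      simp only [integral_const_mul]
      rw [integral_sub_left_eq_self (regKernel p 1)]
    have i2 : ∫ z : Space N × Space N, φ z.2 * regKernel p 1 (z.1 - z.2) =
        ∫ z : Space N × Space N, φ z.1 * regKernel p 1 (z.1 - z.2) := by
      have := integral_prod_swap (μ := (volume : Measure (Space N))) (ν := volume)
        (fun z : Space N × Space N => φ z.1 * regKernel p 1 (z.1 - z.2))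
      rw [Measure.volume_eq_prod, ← this]
      refine integral_congr_ae (Eventually.of_forall fun z => ?_)
      simp only [Prod.fst_swap, Prod.snd_swap]
      rw [regKernel_sub_comm]
    simp only [hB, integral_const_mul, add_mul]
    rw [integral_add hφ1 hφ2, i2, i1]
    ring
  -- the pointwise estimate in the closed half space
  have hφQ : ∀ x, b ≤ inner ℝ e x → φ (Q x) = 0 := fun x hx => by
    refine hφB _ fun hQx => ?_
    have h1 := lt_inner_of_mem_ball he hx₀ hQx
    rw [inner_reflect he] at h1
    linarith
  set G : Space N → Prop := fun x => w (Q x) = -w x ∧ (x ∈ halfSpace e b → w x * φ x = -φ x ^ 2 ∧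
      (x ∈ Metric.ball x₀ (2 * ρ) → -φ x ≤ w x) ∧ (x ∉ Metric.ball x₀ (2 * ρ) → -σ ≤ w x))
    with hG
  have hGae : ∀ᵐ x, G x := by filter_upwards [hwa, h] with x h1 h2 using ⟨h1, h2⟩
  have hGc : ∀ x, G x → b ≤ inner ℝ e x → w x * φ x = -φ x ^ 2 ∧
      (x ∈ Metric.ball x₀ (2 * ρ) → -φ x ≤ w x) ∧ (x ∉ Metric.ball x₀ (2 * ρ) → -σ ≤ w x) := by
    rintro x ⟨h1, h2⟩ hx
    rcases hx.lt_or_eq with hx | hx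
    · exact h2 hx
    · -- on the hyperplane antisymmetry forces `w = 0`
      have hQx : Q x = x := by simp [hQ, reflect, ← hx]
      rw [hQx] at h1
      have hwx : w x = 0 := by linarith
      have hφx := hφQ x hx.le
      rw [hQx] at hφx
      simp [hwx, hφx, hσ]
  set S : Space N × Space N → ℝ :=
    fun z => F z + F (Q z.1, z.2) + F (z.1, Q z.2) + F (Q z.1, Q z.2) with hS
  set D : Space N × Space N → ℝ :=
    fun z => B z + B (Q z.1, z.2) + B (z.1, Q z.2) + B (Q z.1, Q z.2) with hD
  have hfar : ∀ x y, x ∉ Metric.ball x₀ (2 * ρ) →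
      φ y * regKernel p 0 (x - y) ≤ φ y * (c₀ * regKernel p 1 (x - y)) := by
    intro x y hx
    by_cases hy : y ∈ Metric.ball x₀ ρ
    · refine mul_le_mul_of_nonneg_left (regKernel_le_mul_regKernel_one hp0.le (by positivity) ?_)
        (hφ0 y)
      have h1 : ρ ≤ ‖x - y‖ := by
        rw [← dist_eq_norm]
        have := dist_triangle x y x₀
        rw [Metric.mem_ball, not_lt] at hx
        linarith [Metric.mem_ball.1 hy]
      rw [div_mul_eq_mul_div, div_le_iff₀ (by positivity)]
      nlinarith [mul_self_le_mul_self hρ.le h1]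
    · simp [hφB y hy]
  have hcore : ∀ x y, b ≤ inner ℝ e x → b ≤ inner ℝ e y → G x → G y → S (x, y) ≤ B (x, y) := by
    intro x y hx hy hGx hGy
    obtain ⟨hx1, hx2, hx3⟩ := hGc x hGx hx
    obtain ⟨hy1, hy2, hy3⟩ := hGc y hGy hy
    have hSe : S (x, y) = (w x - w y) * (φ x - φ y) * regKernel p 0 (x - y) +
        (w x + w y) * (φ x + φ y) * regKernel p 0 (x - Q y) := by
      have hk : regKernel p 0 (Q x - y) = regKernel p 0 (x - Q y) := by
        simp only [regKernel, hQ, norm_reflect_sub he]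
      simp only [hS, hF, hφQ x hx, hφQ y hy, hGx.1, hGy.1, hk]
      ring
    by_cases hxy : x = y
    -- on the diagonal the kernel of parameter `0` has the junk value `0`
    · subst hxy
      refine le_trans ?_ (hB0 _)
      rw [hSe]
      have : 0 ≤ φ x ^ 2 * regKernel p 0 (x - Q x) :=
        mul_nonneg (sq_nonneg _) (regKernel_nonneg le_rfl _)
      have e1 : (w x - w x) * (φ x - φ x) * regKernel p 0 (x - x) +
          (w x + w x) * (φ x + φ x) * regKernel p 0 (x - Q x) =
          4 * (w x * φ x) * regKernel p 0 (x - Q x) := by ring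
      rw [e1, hx1]
      linarith
    have hk : regKernel p 0 (x - Q y) ≤ regKernel p 0 (x - y) := by
      have hpos : 0 < ‖x - y‖ := norm_pos_iff.2 (sub_ne_zero.2 hxy)
      refine Real.rpow_le_rpow_of_nonpos (by positivity) ?_ (by linarith)
      rw [hQ, norm_sub_reflect_sq he]
      nlinarith [mul_nonneg (sub_nonneg.2 hx) (sub_nonneg.2 hy)]
    obtain ⟨ηx, hηx0, hwx, hηx⟩ : ∃ ηx, 0 ≤ ηx ∧ -φ x - ηx ≤ w x ∧
        φ y * ηx * regKernel p 0 (x - y) ≤ σ * c₀ * (φ y * regKernel p 1 (x - y)) := by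
      by_cases hxb : x ∈ Metric.ball x₀ (2 * ρ)
      · refine ⟨0, le_rfl, by linarith [hx2 hxb], ?_⟩
        rw [mul_zero, zero_mul]
        exact mul_nonneg (mul_nonneg hσ hc₀0)
          (mul_nonneg (hφ0 y) (regKernel_nonneg zero_le_one _))
      · refine ⟨σ, hσ, by linarith [hx3 hxb, hφ0 x], ?_⟩
        have := mul_le_mul_of_nonneg_left (hfar x y hxb) hσ
        linarith
    obtain ⟨ηy, hηy0, hwy, hηy⟩ : ∃ ηy, 0 ≤ ηy ∧ -φ y - ηy ≤ w y ∧
        φ x * ηy * regKernel p 0 (x - y) ≤ σ * c₀ * (φ x * regKernel p 1 (x - y)) := by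
      by_cases hyb : y ∈ Metric.ball x₀ (2 * ρ)
      · refine ⟨0, le_rfl, by linarith [hy2 hyb], ?_⟩
        rw [mul_zero, zero_mul]
        exact mul_nonneg (mul_nonneg hσ hc₀0)
          (mul_nonneg (hφ0 x) (regKernel_nonneg zero_le_one _))
      · refine ⟨σ, hσ, by linarith [hy3 hyb, hφ0 y], ?_⟩
        have := mul_le_mul_of_nonneg_left (hfar y x hyb) hσ
        rw [regKernel_sub_comm y x, regKernel_sub_comm y x] at this
        linarith
    have := antisymm_test_le (hφ0 x) (hφ0 y) hηx0 hηy0 (regKernel_nonneg le_rfl _) hk hx1 hy1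
      hwx hwy
    rw [hSe]
    simp only [hB]
    linarith
  have hQmp := measurePreserving_reflect (b := b) he
  have hSD : ∀ᵐ z, S z ≤ D z := by
    have hG2 : ∀ᵐ x, G x ∧ G (Q x) := hGae.and (hQmp.quasiMeasurePreserving.ae hGae)
    rw [Measure.volume_eq_prod]
    filter_upwards [Measure.quasiMeasurePreserving_fst.ae hG2,
      Measure.quasiMeasurePreserving_snd.ae hG2] with z h1 h2
    obtain ⟨x, y⟩ := z
    simp only at h1 h2
    have hQb : ∀ x, ¬ b ≤ inner ℝ e x → b ≤ inner ℝ e (Q x) := fun x hx => by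
      have := inner_reflect (b := b) he x
      linarith [not_le.1 hx]
    have b1 := hB0 (x, y)
    have b2 := hB0 (Q x, y)
    have b3 := hB0 (x, Q y)
    have b4 := hB0 (Q x, Q y)
    by_cases hx : b ≤ inner ℝ e x <;> by_cases hy : b ≤ inner ℝ e y
    · have := hcore x y hx hy h1.1 h2.1
      simp only [hS, hD] at this ⊢
      linarith
    · have := hcore x (Q y) hx (hQb y hy) h1.1 h2.2
      simp only [hS, hD, hQQ] at this ⊢
      linarith
    · have := hcore (Q x) y (hQb x hx) hy h1.2 h2.1
      simp only [hS, hD, hQQ] at this ⊢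
      linarith
    · have := hcore (Q x) (Q y) (hQb x hx) (hQb y hy) h1.2 h2.2
      simp only [hS, hD, hQQ] at this ⊢
      linarith
  have hFB : ∫ z, F z ≤ ∫ z, B z := by
    have h1 := integral_mono_ae (integral_sum_reflect he F hFi).1
      (integral_sum_reflect he B hBi).1 hSD
    rw [(integral_sum_reflect he F hFi).2, (integral_sum_reflect he B hBi).2] at h1
    linarith
  rw [energy_eq]
  have hf := fracConst_pos N hs0 hs1
  calc _ ≤ fracConst N s / 2 * ∫ z, B z := mul_le_mul_of_nonneg_left hFB (by positivity)
    _ = _ := by rw [hBint]; ring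

end AntisymmetricEnergy

/-- The test function `max(0, min(κ u - v, κ u))`. Where `v ≥ 0` it is the positive part of
`κ u - v`, and it vanishes where `u` does. -/
noncomputable def testFun {N : ℕ} (κ : ℝ) (u v : Space N → ℝ) (x : Space N) : ℝ :=
  max 0 (min (κ * u x - v x) (κ * u x))

section TestFunction

variable {N : ℕ} {s A ρ κ : ℝ} {x₀ : Space N} {u v : Space N → ℝ} {e : Space N} {b : ℝ}

lemma testFun_nonneg (x : Space N) : 0 ≤ testFun κ u v x := le_max_left _ _

lemma testFun_le (hκ : 0 ≤ κ) (hu : 0 ≤ u) (x : Space N) : testFun κ u v x ≤ κ * u x :=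
  max_le (mul_nonneg hκ (hu x)) (min_le_right _ _)

lemma testFun_of_eq_zero {x : Space N} (hx : u x = 0) : testFun κ u v x = 0 := by
  simp [testFun, hx]

lemma testFun_of_nonneg {x : Space N} (hx : 0 ≤ v x) :
    testFun κ u v x = max (κ * u x - v x) 0 := by
  rw [testFun, min_eq_left (by linarith), max_comm]

lemma MemHs.testFun (hu : MemHs s u) (hv : MemHs s v) (κ : ℝ) : MemHs s (testFun κ u v) := by
  have hg := hu.const_mul κ
  have hf := hg.sub hv
  refine hf.of_abs_sub_le hg ?_ (fun x => ?_) fun x y => ?_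
  · exact (aemeasurable_const.max
      (hf.1.1.aemeasurable.min hg.1.1.aemeasurable)).aestronglyMeasurable
  · have h1 := abs_max_sub_max_le_abs (min (κ * u x - v x) (κ * u x)) 0 0
    have h2 := abs_min_sub_min_le_max (κ * u x - v x) (κ * u x) 0 0
    have h3 := max_le_add_of_nonneg (abs_nonneg (κ * u x - v x)) (abs_nonneg (κ * u x))
    simp only [max_self, min_self, sub_zero] at h1 h2
    rw [FracParabolic.testFun, max_comm]
    exact (h1.trans h2).trans h3
  · have h1 := abs_max_sub_max_le_abs (min (κ * u x - v x) (κ * u x))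
      (min (κ * u y - v y) (κ * u y)) 0
    have h2 := abs_min_sub_min_le_max (κ * u x - v x) (κ * u x) (κ * u y - v y) (κ * u y)
    rw [FracParabolic.testFun, FracParabolic.testFun, max_comm 0, max_comm 0]
    exact (h1.trans h2).trans (max_le_add_of_nonneg (abs_nonneg _) (abs_nonneg _))

lemma IsBump.integrable_testFun (hu : IsBump (N / 2 + s) A ρ x₀ u) (hκ : 0 ≤ κ)
    (hv : AEStronglyMeasurable v) : Integrable (testFun κ u v) := by
  have hm := hu.measurable.const_mul κ
  refine (hu.integrable.const_mul κ).mono' (aemeasurable_const.max ((hm.aemeasurable.sub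
    hv.aemeasurable).min hm.aemeasurable)).aestronglyMeasurable
    (Eventually.of_forall fun x => ?_)
  rw [Real.norm_of_nonneg (testFun_nonneg x)]
  exact testFun_le hκ hu.nonneg x

/-- The estimate at a fixed time: an antisymmetric function that is nonnegative on `B_{2ρ}(x₀)` and
at least `-σ` on the rest of the half space, with `σ` small compared to `κ`, has energy at most
`C κ ∫ u φ` against the test function `φ = (κ u - v)⁺`. -/
lemma exists_energy_testFun_le (N : ℕ) (hs0 : 0 < s) (hs1 : s < 1) (hρ : 0 < ρ) (hA : 0 ≤ A)
    {m : ℝ} (hm : 0 < m) :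
    ∃ C ≥ (0 : ℝ), ∃ q > (0 : ℝ), ∀ (e : Space N) (b : ℝ), ‖e‖ = 1 →
      ∀ x₀, 2 * ρ ≤ inner ℝ e x₀ - b → ∀ u, IsBump (N / 2 + s) A ρ x₀ u → m ≤ ∫ x, u x →
      ∀ v, MemHs s v → Antisymmetric e b v → ∀ κ σ, 0 ≤ σ → q * σ ≤ κ →
        (∀ᵐ x, x ∈ Metric.ball x₀ (2 * ρ) → 0 ≤ v x) →
        (∀ᵐ x, x ∈ halfSpace e b \ Metric.ball x₀ (2 * ρ) → -σ ≤ v x) →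
        energy s v (testFun κ u v) ≤ C * κ * ∫ x, u x * testFun κ u v x := by
  obtain ⟨C, hC, a, ha, H⟩ := exists_energy_antisymm_le (N := N) hs0 hs1 hρ hA hm
  have hf := fracConst_pos N hs0 hs1
  set c₁ : ℝ := (ρ ^ 2 / (1 + ρ ^ 2)) ^ (-((N : ℝ) / 2 + s)) *
    ∫ z : Space N, regKernel ((N : ℝ) / 2 + s) 1 z with hc₁
  have hc₁0 : 0 < c₁ :=
    mul_pos (by positivity) (integral_regKernel_pos (by linarith) one_pos)
  refine ⟨fracConst N s * C, by positivity, c₁ / a, by positivity,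
    fun e b he x₀ hx₀ u hu hmu v hv hva κ σ hσ hσκ hv0 hvσ => ?_⟩
  have hκ : 0 ≤ κ := le_trans (by positivity) hσκ
  have huH := hu.memHs hA hs0 hs1
  have hφ := huH.testFun hv κ
  have hφi := hu.integrable_testFun hκ hv.1.1
  have hφB : ∀ x ∉ Metric.ball x₀ ρ, testFun κ u v x = 0 := fun x hx =>
    testFun_of_eq_zero (hu.eq_zero x hx)
  have hU := H e b he x₀ hx₀ u hu hmu _ hφ hφi testFun_nonneg hφB
  have hUH := hu.memHs_antisymm (b := b) hA hs0 hs1 he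
  have hw : MemHs s fun x => v x - κ * (u x - u (reflect e b x)) := hv.sub (hUH.const_mul κ)
  have hwa : Antisymmetric e b fun x => v x - κ * (u x - u (reflect e b x)) := by
    filter_upwards [hva] with x hx
    rw [hx, reflect_reflect he]
    ring
  have hW := energy_negPart_le hs0 hs1 hρ he hx₀ hw hwa hφ hφi testFun_nonneg hφB hσ (by
    filter_upwards [hv0, hvσ] with x h1 h2 hxH
    have hux : u (reflect e b x) = 0 := by
      refine hu.eq_zero _ fun hQx => ?_
      have h3 := lt_inner_of_mem_ball he hx₀ hQx
      rw [inner_reflect he] at h3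
      have : b < inner ℝ e x := hxH
      linarith
    rw [hux, sub_zero]
    by_cases hx : x ∈ Metric.ball x₀ (2 * ρ)
    · rw [testFun_of_nonneg (h1 hx)]
      refine ⟨?_, fun _ => ?_, fun h => absurd hx h⟩
      · rcases le_total (κ * u x - v x) 0 with h | h
        · simp [max_eq_right h]
        · rw [max_eq_left h]; ring
      · linarith [le_max_left (κ * u x - v x) 0]
    · have hx' : x ∉ Metric.ball x₀ ρ := fun h =>
        hx (Metric.ball_subset_ball (by linarith) h)
      rw [hφB x hx', hu.eq_zero x hx']
      refine ⟨by ring, fun h => absurd h hx, fun _ => ?_⟩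
      rw [mul_zero, sub_zero]
      exact h2 ⟨hxH, hx⟩)
  rw [energy_sub hv (hUH.const_mul κ) hφ, energy_const_mul] at hW
  have hφ0 : 0 ≤ ∫ x, testFun κ u v x := integral_nonneg testFun_nonneg
  have h1 := mul_le_mul_of_nonneg_left hU hκ
  have h2 : c₁ * σ ≤ κ * a := by
    rwa [div_mul_eq_mul_div, div_le_iff₀ ha] at hσκ
  have h3 := mul_le_mul_of_nonneg_left (mul_le_mul_of_nonneg_right h2 hφ0) hf.le
  linarith

end TestFunction

/-! ### Supersolutions at every time -/

section EveryTime

variable {N : ℕ} {s : ℝ} {U U' : Set (Space N)} {φ : Space N → ℝ}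

/-- For a fixed test function supported in `U`, the energy is bounded by the norm of `𝓥^s(U')`: the
Cauchy-Schwarz inequality controls the integral over `U' × U'`, and elsewhere the kernel is bounded
where the test function does not vanish. -/
lemma exists_abs_energy_le (hs0 : 0 < s) (hU' : IsOpen U') (hUb : Bornology.IsBounded U)
    (hUU' : closure U ⊆ U') (hφ : MemHs s φ) (hφi : Integrable φ) (hφU : ∀ x ∉ U, φ x = 0) :
    ∃ K < ∞, ∀ d : Space N → ℝ, AEStronglyMeasurable d →
      ENNReal.ofReal |energy s d φ| ≤ K * normV s U' d := by
  set p : ℝ := N / 2 + s with hp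
  have hp0 : 0 < p := by positivity
  have hpN : (N : ℝ) / 2 < p := by linarith
  obtain ⟨r, hr, hrU⟩ := (hUb.isCompact_closure).exists_thickening_subset_open hU' hUU'
  have hdist : ∀ x ∈ U, ∀ y ∉ U', r ≤ ‖x - y‖ := by
    intro x hx y hy
    by_contra! h
    refine hy (hrU (Metric.mem_thickening_iff.2 ⟨x, subset_closure hx, ?_⟩))
    rwa [dist_comm, dist_eq_norm]
  set c₀ : ℝ := (r ^ 2 / (1 + r ^ 2)) ^ (-p) with hc₀
  have hker : ∀ z : Space N, r ≤ ‖z‖ → ‖regKernel p 0 z‖ₑ ≤ ‖c₀ * regKernel p 1 z‖ₑ := by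
    intro z hz
    refine enorm_le_iff_norm_le.2 ?_
    have h0 : 0 ≤ c₀ * regKernel p 1 z :=
      mul_nonneg (by positivity) (regKernel_nonneg zero_le_one z)
    rw [Real.norm_of_nonneg (regKernel_nonneg le_rfl z), Real.norm_of_nonneg h0]
    refine regKernel_le_mul_regKernel_one hp0.le (by positivity) ?_
    rw [div_mul_eq_mul_div, div_le_iff₀ (by positivity)]
    nlinarith [mul_self_le_mul_self hr.le hz]
  set g : Space N × Space N → ℝ :=
    fun z => (|φ z.1| + |φ z.2|) * (c₀ * regKernel p 1 (z.1 - z.2)) with hg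
  have hgi : Integrable g := by
    have h1 := integrable_fst_mul_regKernel (N := N) hpN one_pos hφi.norm
    have h2 : Integrable fun z : Space N × Space N => ‖φ z.2‖ * regKernel p 1 (z.1 - z.2) := by
      refine h1.swap.congr (Eventually.of_forall fun z => ?_)
      simp only [Function.comp, Prod.fst_swap, Prod.snd_swap]
      rw [regKernel_sub_comm]
    refine ((h1.add h2).const_mul c₀).congr (Eventually.of_forall fun z => ?_)
    simp only [hg, Pi.add_apply, Real.norm_eq_abs]
    ring
  set L : ℝ≥0∞ := ∫⁻ z, ‖g z‖ₑ with hL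
  have hLt : L < ∞ := hgi.2
  refine ⟨ENNReal.ofReal |fracConst N s / 2| * (gagliardoSq s Set.univ φ ^ (1 / 2 : ℝ) + 2 * L),
    ENNReal.mul_lt_top ENNReal.ofReal_lt_top (ENNReal.add_lt_top.2
      ⟨ENNReal.rpow_lt_top_of_nonneg (by norm_num) hφ.2.ne,
        ENNReal.mul_lt_top (by simp) hLt⟩), fun d hd => ?_⟩
  set M := eLpNorm d ∞ volume with hM
  have hdM : ∀ᵐ x, ‖d x‖ₑ ≤ M := by
    rw [hM, eLpNorm_exponent_top]; exact ae_le_eLpNormEssSup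
  rw [energy_eq, abs_mul, ENNReal.ofReal_mul (abs_nonneg _), mul_assoc]
  refine mul_le_mul_right ?_ _
  rw [← Real.enorm_eq_ofReal_abs]
  have hcs : ∫⁻ z in U' ×ˢ U', ‖diffQuot s d z‖ₑ * ‖diffQuot s φ z‖ₑ ≤
      gagliardoSq s U' d ^ (1 / 2 : ℝ) * gagliardoSq s Set.univ φ ^ (1 / 2 : ℝ) := by
    have h1 := ENNReal.lintegral_mul_le_Lp_mul_Lq (volume.restrict (U' ×ˢ U'))
      Real.HolderConjugate.two_two
      (aestronglyMeasurable_diffQuot (s := s) hd).enorm.restrict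
      (aestronglyMeasurable_diffQuot (s := s) hφ.1.1).enorm.restrict
    simp only [Pi.mul_apply, ENNReal.rpow_ofNat] at h1
    refine h1.trans ?_
    rw [← gagliardoSq_eq, ← gagliardoSq_eq]
    gcongr
    exact lintegral_mono_set (by simp)
  have hpt : ∀ᵐ z : Space N × Space N,
      ‖(d z.1 - d z.2) * (φ z.1 - φ z.2) * regKernel p 0 (z.1 - z.2)‖ₑ ≤
      (U' ×ˢ U').indicator (fun z => ‖diffQuot s d z‖ₑ * ‖diffQuot s φ z‖ₑ) z +
        2 * M * ‖g z‖ₑ := by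
    rw [Measure.volume_eq_prod]
    filter_upwards [Measure.quasiMeasurePreserving_fst.ae hdM,
      Measure.quasiMeasurePreserving_snd.ae hdM] with z h1 h2
    by_cases hz : z ∈ U' ×ˢ U'
    · rw [Set.indicator_of_mem hz, ← enorm_mul, diffQuot_mul_diffQuot]
      exact le_self_add
    · refine le_trans ?_ le_add_self
      by_cases hφz : φ z.1 = 0 ∧ φ z.2 = 0
      · simp [hφz.1, hφz.2]
      have hsub : ∀ x, x ∉ U' → φ x = 0 := fun x hx =>
        hφU x fun h => hx (hUU' (subset_closure h))
      have hrz : r ≤ ‖z.1 - z.2‖ := by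
        rcases not_and_or.1 (fun h => hz (Set.mem_prod.2 h)) with h | h
        · have : z.2 ∈ U := by
            by_contra h'
            exact hφz ⟨hsub _ h, hφU _ h'⟩
          rw [norm_sub_rev]
          exact hdist _ this _ h
        · have : z.1 ∈ U := by
            by_contra h'
            exact hφz ⟨hφU _ h', hsub _ h⟩
          exact hdist _ this _ h
      simp only [hg]
      rw [enorm_mul, enorm_mul, enorm_mul, mul_assoc]
      refine mul_le_mul' ?_ (mul_le_mul' ?_ (hker _ hrz))
      · calc ‖d z.1 - d z.2‖ₑ ≤ ‖d z.1‖ₑ + ‖d z.2‖ₑ := enorm_sub_le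
          _ ≤ 2 * M := by rw [two_mul]; exact add_le_add h1 h2
      · refine enorm_le_iff_norm_le.2 ?_
        rw [Real.norm_of_nonneg (add_nonneg (abs_nonneg (φ z.1)) (abs_nonneg (φ z.2)))]
        exact abs_sub _ _
  calc ‖∫ z : Space N × Space N, (d z.1 - d z.2) * (φ z.1 - φ z.2) *
        regKernel p 0 (z.1 - z.2)‖ₑ
      ≤ ∫⁻ z : Space N × Space N,
        ‖(d z.1 - d z.2) * (φ z.1 - φ z.2) * regKernel p 0 (z.1 - z.2)‖ₑ :=
        enorm_integral_le_lintegral_enorm _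
    _ ≤ ∫⁻ z, ((U' ×ˢ U').indicator (fun z => ‖diffQuot s d z‖ₑ * ‖diffQuot s φ z‖ₑ) z +
        2 * M * ‖g z‖ₑ) := lintegral_mono_ae hpt
    _ = (∫⁻ z in U' ×ˢ U', ‖diffQuot s d z‖ₑ * ‖diffQuot s φ z‖ₑ) + 2 * M * L := by
        rw [lintegral_add_right' _ (hgi.1.enorm.const_mul _),
          lintegral_indicator (hU'.measurableSet.prod hU'.measurableSet),
          lintegral_const_mul'' _ hgi.1.enorm]
    _ ≤ gagliardoSq s U' d ^ (1 / 2 : ℝ) * gagliardoSq s Set.univ φ ^ (1 / 2 : ℝ) + 2 * M * L :=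
        add_le_add hcs le_rfl
    _ ≤ normV s U' d * gagliardoSq s Set.univ φ ^ (1 / 2 : ℝ) + normV s U' d * (2 * L) := by
        refine add_le_add (mul_le_mul' le_add_self le_rfl) ?_
        calc 2 * M * L = M * (2 * L) := by ring
          _ ≤ _ := mul_le_mul' le_self_add le_rfl
    _ = _ := by ring

lemma continuousOn_energy (hs0 : 0 < s) (hU' : IsOpen U') (hUb : Bornology.IsBounded U)
    (hUU' : closure U ⊆ U') (hφ : MemHs s φ) (hφi : Integrable φ) (hφU : ∀ x ∉ U, φ x = 0)
    {T : Set ℝ} {v : ℝ → Space N → ℝ} (hv : ContinuousInV s T U' v) (hvH : ∀ t ∈ T, MemHs s (v t)) :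
    ContinuousOn (fun t => energy s (v t) φ) T := by
  obtain ⟨K, hK, H⟩ := exists_abs_energy_le hs0 hU' hUb hUU' hφ hφi hφU
  intro t ht
  rw [ContinuousWithinAt, tendsto_iff_edist_tendsto_0]
  have h0 := ENNReal.Tendsto.const_mul (hv.2 t ht) (Or.inr hK.ne)
  rw [mul_zero] at h0
  refine tendsto_of_tendsto_of_tendsto_of_le_of_le' tendsto_const_nhds h0
    (Eventually.of_forall fun _ => zero_le) ?_
  filter_upwards [self_mem_nhdsWithin] with τ hτ
  rw [edist_dist, Real.dist_eq, ← energy_sub (hvH τ hτ) (hvH t ht) hφ]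
  exact H _ ((hvH τ hτ).1.1.sub (hvH t ht).1.1)

lemma inner_toLp_eq_integral {μ : Measure (Space N)} (f : Lp ℝ 2 μ) (hφ : MemLp φ 2 μ) :
    inner ℝ f (hφ.toLp φ) = ∫ x, f x * φ x ∂μ := by
  rw [L2.inner_def]
  refine integral_congr_ae ?_
  filter_upwards [hφ.coeFn_toLp] with x hx
  rw [hx]
  simp [mul_comm]

/-- For a supersolution that is nonnegative on `U`, the potential may be replaced by `-cInf`; both
sides of the inequality for a fixed test function are then continuous in time, so that it holds at
every time and not only at almost every time. -/
lemma energy_ge_of_isSupersolution (hs0 : 0 < s) {t₀ t₁ : ℝ} (ht : t₀ < t₁)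
    {c v : ℝ → Space N → ℝ} (hU' : IsOpen U')
    (hUb : Bornology.IsBounded U) (hUU' : closure U ⊆ U')
    (hv : ContinuousInV s (Set.Icc t₀ t₁) U' v) (hvH : ∀ t ∈ Set.Icc t₀ t₁, MemHs s (v t))
    (hv0 : ∀ t ∈ Set.Icc t₀ t₁, ∀ᵐ x ∂(volume.restrict U), 0 ≤ v t x)
    (hcm : MemLp (Function.uncurry c) ∞ (volume.restrict (Set.Icc t₀ t₁ ×ˢ U))) {cInf : ℝ}
    (hcInf : 0 ≤ cInf)
    (hc : eLpNorm (Function.uncurry c) ∞ (volume.restrict (Set.Icc t₀ t₁ ×ˢ U)) ≤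
      ENNReal.ofReal cInf)
    {V : ℝ → Lp ℝ 2 (volume.restrict U)}
    (hVv : ∀ t ∈ Set.Icc t₀ t₁, V t =ᵐ[volume.restrict U] v t)
    (hV : ContDiffOn ℝ 1 V (Set.Icc t₀ t₁))
    (hφ : MemHs s φ) (hφi : Integrable φ) (hφU : ∀ x ∉ U, φ x = 0) (hφ0 : ∀ x, 0 ≤ φ x)
    (hsup : ∀ᵐ t ∂(volume.restrict (Set.Icc t₀ t₁)), energy s (v t) φ ≥
      ∫ x in U, (c t x * v t x - derivWithin V (Set.Icc t₀ t₁) t x) * φ x)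
    {t : ℝ} (htT : t ∈ Set.Icc t₀ t₁) :
    -cInf * inner ℝ (V t) ((hφ.1.restrict U).toLp φ) -
      inner ℝ (derivWithin V (Set.Icc t₀ t₁) t) ((hφ.1.restrict U).toLp φ) ≤
        energy s (v t) φ := by
  set T := Set.Icc t₀ t₁ with hT
  set P := (hφ.1.restrict U).toLp φ with hP
  set R : ℝ → ℝ := fun t => -cInf * inner ℝ (V t) P - inner ℝ (derivWithin V T t) P with hR
  have hE := continuousOn_energy hs0 hU' hUb hUU' hφ hφi hφU hv hvH
  have hRc : ContinuousOn R T := by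
    have h1 := hV.continuousOn
    have h2 := hV.continuousOn_derivWithin (uniqueDiffOn_Icc ht) le_rfl
    exact ((h1.inner continuousOn_const).const_mul _ |>.congr fun _ _ => rfl).sub
      (h2.inner continuousOn_const)
  have hcae : ∀ᵐ t ∂(volume.restrict T), ∀ᵐ x ∂(volume.restrict U), ‖c t x‖ ≤ cInf := by
    refine Measure.ae_ae_of_ae_prod (p := fun z : ℝ × Space N => ‖c z.1 z.2‖ ≤ cInf) ?_
    rw [Measure.prod_restrict, ← Measure.volume_eq_prod]
    rw [eLpNorm_exponent_top] at hc
    filter_upwards [ae_le_eLpNormEssSup (f := Function.uncurry c)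
      (μ := volume.restrict (T ×ˢ U))] with z hz
    have h1 := hz.trans hc
    rw [← ofReal_norm, ENNReal.ofReal_le_ofReal_iff hcInf] at h1
    exact h1
  have hcmeas : ∀ᵐ t ∂(volume.restrict T), AEStronglyMeasurable (c t) (volume.restrict U) := by
    have h1 := hcm.1
    rw [Measure.volume_eq_prod, ← Measure.prod_restrict] at h1
    exact h1.prodMk_left
  have hae : ∀ᵐ t ∂(volume.restrict T), R t ≤ energy s (v t) φ := by
    filter_upwards [hsup, hcae, hcmeas, ae_restrict_mem measurableSet_Icc] with t h1 h2 h3 h4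
    refine le_trans ?_ h1
    have hvφ : Integrable (fun x => v t x * φ x) (volume.restrict U) :=
      ((hvH t h4).1.integrable_mul hφ.1).restrict
    have hVφ : Integrable (fun x => V t x * φ x) (volume.restrict U) :=
      (Lp.memLp (V t)).integrable_mul (hφ.1.restrict U)
    have hDφ : Integrable (fun x => derivWithin V T t x * φ x) (volume.restrict U) :=
      (Lp.memLp (derivWithin V T t)).integrable_mul (hφ.1.restrict U)
    have hcvφ : Integrable (fun x => c t x * (v t x * φ x)) (volume.restrict U) := by
      refine (hvφ.norm.const_mul cInf).mono' (h3.mul hvφ.1) ?_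
      filter_upwards [h2] with x hx
      rw [norm_mul]
      exact mul_le_mul_of_nonneg_right hx (norm_nonneg _)
    simp only [hR, hP]
    rw [inner_toLp_eq_integral, inner_toLp_eq_integral, ← integral_const_mul,
      ← integral_sub (hVφ.const_mul _) hDφ]
    refine integral_mono_ae ((hVφ.const_mul _).sub hDφ) ?_ ?_
    · refine (hcvφ.sub hDφ).congr (Eventually.of_forall fun x => ?_)
      simp only [Pi.sub_apply]; ring
    · filter_upwards [h2, hVv t h4, hv0 t h4] with x hx hVx hvx
      rw [hVx]
      have h5 := mul_nonneg hvx (hφ0 x)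
      have h6 := (abs_le.1 hx).1
      have h7 := mul_le_mul_of_nonneg_right h6 h5
      linarith
  -- `R ≤ 𝓔` is written as the equality `R = min R 𝓔` of functions continuous on `T`
  have heq := Measure.eqOn_Icc_of_ae_eq volume ht.ne (f := R)
    (g := fun t => min (R t) (energy s (v t) φ))
    (by filter_upwards [hae] with t h1 using (min_eq_left h1).symm) hRc
    (ContinuousOn.inf hRc hE)
  have := heq htT
  simp only at this
  exact this.le.trans (min_le_right _ _)

end EveryTime

/-! ### The squared norm of the positive part along a curve in `L²` -/

section PosPart

variable {α : Type*} {m : MeasurableSpace α} {μ : Measure α}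

/-- First order expansion of `‖f⁺‖²` in `L²`. -/
lemma abs_norm_posPart_sq_sub_le (f g : Lp ℝ 2 μ) :
    |‖Lp.posPart g‖ ^ 2 - ‖Lp.posPart f‖ ^ 2 - 2 * inner ℝ (Lp.posPart f) (g - f)| ≤
      ‖g - f‖ ^ 2 := by
  have hsq : ∀ h : Lp ℝ 2 μ, ‖h‖ ^ 2 = inner ℝ h h := fun h => (real_inner_self_eq_norm_sq h).symm
  have i1 := L2.integrable_inner (𝕜 := ℝ) (Lp.posPart g) (Lp.posPart g)
  have i2 := L2.integrable_inner (𝕜 := ℝ) (Lp.posPart f) (Lp.posPart f)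
  have i12 : Integrable (fun x => inner ℝ (Lp.posPart g x) (Lp.posPart g x) -
      inner ℝ (Lp.posPart f x) (Lp.posPart f x)) μ := i1.sub i2
  have i3 := (L2.integrable_inner (𝕜 := ℝ) (Lp.posPart f) (g - f)).const_mul 2
  have i4 := L2.integrable_inner (𝕜 := ℝ) (g - f) (g - f)
  rw [hsq, hsq, hsq, L2.inner_def, L2.inner_def, L2.inner_def, L2.inner_def,
    ← integral_const_mul, ← integral_sub i1 i2, ← integral_sub i12 i3]
  refine (abs_integral_le_integral_abs).trans (integral_mono_ae (i12.sub i3).abs i4 ?_)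
  filter_upwards [Lp.coeFn_posPart f, Lp.coeFn_posPart g, Lp.coeFn_sub g f] with x h1 h2 h3
  simp only [h1, h2, h3, Pi.sub_apply, RCLike.inner_apply, conj_trivial]
  rw [abs_le]
  rcases le_total (f x) 0 with hf | hf <;> rcases le_total (g x) 0 with hg | hg <;>
    simp only [max_eq_left, max_eq_right, hf, hg] <;> constructor <;>
    nlinarith [sq_nonneg (f x), sq_nonneg (g x), sq_nonneg (g x - f x)]

lemma hasFDerivAt_norm_posPart_sq (f : Lp ℝ 2 μ) :
    HasFDerivAt (fun g : Lp ℝ 2 μ => ‖Lp.posPart g‖ ^ 2)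
      ((2 : ℝ) • innerSL ℝ (Lp.posPart f)) f := by
  rw [hasFDerivAt_iff_isLittleO]
  have h1 : (fun g => ‖Lp.posPart g‖ ^ 2 - ‖Lp.posPart f‖ ^ 2 -
      ((2 : ℝ) • innerSL ℝ (Lp.posPart f)) (g - f)) =O[𝓝 f] fun g => ‖g - f‖ ^ 2 := by
    refine Asymptotics.IsBigO.of_bound 1 (Eventually.of_forall fun g => ?_)
    rw [one_mul, Real.norm_eq_abs, Real.norm_of_nonneg (sq_nonneg _)]
    simpa using abs_norm_posPart_sq_sub_le f g
  refine h1.trans_isLittleO ?_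
  have h2 : Tendsto (fun g : Lp ℝ 2 μ => g - f) (𝓝 f) (𝓝 0) := by
    have : Tendsto (fun g : Lp ℝ 2 μ => g - f) (𝓝 f) (𝓝 (f - f)) :=
      (continuous_id.sub continuous_const).tendsto f
    rwa [sub_self] at this
  exact (Asymptotics.isLittleO_norm_pow_id one_lt_two).comp_tendsto h2

/-- A curve in `L²` that starts nonpositive and whose velocity has nonpositive inner product with
its positive part remains nonpositive. -/
lemma posPart_eq_zero_of_inner_deriv_nonpos {t₀ t₁ : ℝ} {f f' : ℝ → Lp ℝ 2 μ}
    (hf : ContinuousOn f (Set.Icc t₀ t₁)) (hf' : ∀ t ∈ Set.Ioo t₀ t₁, HasDerivAt f (f' t) t)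
    (hle : ∀ t ∈ Set.Ioo t₀ t₁, inner ℝ (Lp.posPart (f t)) (f' t) ≤ 0)
    (h0 : Lp.posPart (f t₀) = 0) {t : ℝ} (ht : t ∈ Set.Icc t₀ t₁) : Lp.posPart (f t) = 0 := by
  have hd : ∀ t ∈ Set.Ioo t₀ t₁, HasDerivAt (fun t => ‖Lp.posPart (f t)‖ ^ 2)
      (2 * inner ℝ (Lp.posPart (f t)) (f' t)) t := fun t ht => by
    have := (hasFDerivAt_norm_posPart_sq (f t)).comp_hasDerivAt t (hf' t ht)
    exact this
  have hanti : AntitoneOn (fun t => ‖Lp.posPart (f t)‖ ^ 2) (Set.Icc t₀ t₁) := by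
    refine antitoneOn_of_deriv_nonpos (convex_Icc _ _) ?_ ?_ ?_
    · exact ((Lp.continuous_posPart.comp_continuousOn hf).norm).pow 2
    · rw [interior_Icc]
      exact fun t ht => (hd t ht).differentiableAt.differentiableWithinAt
    · rw [interior_Icc]
      intro t ht
      rw [(hd t ht).deriv]
      linarith [hle t ht]
  have h1 := hanti (Set.left_mem_Icc.2 (ht.1.trans ht.2)) ht ht.1
  simp only [h0, norm_zero] at h1
  have h2 : ‖Lp.posPart (f t)‖ = 0 := by
    have := sq_nonneg ‖Lp.posPart (f t)‖
    exact pow_eq_zero_iff two_ne_zero |>.1 (le_antisymm (by simpa using h1) this)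
  exact norm_eq_zero.1 h2

end PosPart

/-! ### The first eigenfunction as a bump -/

section Eigenfunction

variable {N : ℕ} {s ρ lam : ℝ} {Ψ : Space N → ℝ}

lemma le_of_ae_le_of_continuousOn {U : Set (Space N)} (hU : IsOpen U) {f g : Space N → ℝ}
    (hf : ContinuousOn f U) (hg : ContinuousOn g U) (h : ∀ᵐ x ∂(volume.restrict U), f x ≤ g x) :
    ∀ x ∈ U, f x ≤ g x := by
  have heq := Measure.eqOn_open_of_ae_eq (μ := (volume : Measure (Space N))) (f := f)
    (g := fun x => min (f x) (g x))
    (by filter_upwards [h] with x hx using (min_eq_left hx).symm) hU hf (ContinuousOn.inf hf hg)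
  intro x hx
  exact (heq hx).le.trans (min_le_right _ _)

lemma meanDeficit_comp_sub (p : ℝ) (f : Space N → ℝ) (x₀ x : Space N) (r : ℝ) :
    meanDeficit p (fun x => f (x - x₀)) x r = meanDeficit p f (x - x₀) r := by
  simp only [meanDeficit, add_sub_right_comm]

lemma IsNormalizedFirstEigenfunction.le_one (hΨ : IsNormalizedFirstEigenfunction ρ Ψ) :
    ∀ x ∈ Metric.ball (0 : Space N) ρ, Ψ x ≤ 1 := by
  obtain ⟨⟨lam, -, hlam⟩, -, hnorm⟩ := hΨ
  refine le_of_ae_le_of_continuousOn Metric.isOpen_ball hlam.1.continuousOn continuousOn_const ?_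
  rw [eLpNorm_exponent_top] at hnorm
  filter_upwards [ae_le_eLpNormEssSup (f := Ψ)
    (μ := volume.restrict (Metric.ball (0 : Space N) ρ))] with x hx
  rw [hnorm, ← ofReal_norm, ENNReal.ofReal_le_one] at hx
  exact (le_abs_self _).trans hx

lemma IsNormalizedFirstEigenfunction.exists_half_le (hΨ : IsNormalizedFirstEigenfunction ρ Ψ) :
    ∃ x ∈ Metric.ball (0 : Space N) ρ, 1 / 2 ≤ Ψ x := by
  obtain ⟨-, hpos, hnorm⟩ := hΨ
  by_contra! h
  have h1 : eLpNorm Ψ ∞ (volume.restrict (Metric.ball (0 : Space N) ρ)) ≤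
      ENNReal.ofReal (1 / 2) := by
    rw [eLpNorm_exponent_top]
    refine eLpNormEssSup_le_of_ae_bound ?_
    filter_upwards [ae_restrict_mem measurableSet_ball] with x hx
    rw [Real.norm_of_nonneg (hpos x hx).le]
    exact (h x hx).le
  rw [hnorm, ENNReal.one_le_ofReal] at h1
  norm_num at h1

lemma isBump_eigenfunction (hs0 : 0 < s) (hρ : 0 < ρ) (hlam : IsFirstDirichletEigenvalue N ρ lam)
    (hΨ : IsNormalizedFirstEigenfunction ρ Ψ) (x₀ : Space N) :
    IsBump (N / 2 + s) (|lam| / (4 * (N / 2 + s)) *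
        ∫ z : Space N, regKernel ((N : ℝ) / 2 + s) 1 z) ρ x₀
      (fun x => (Metric.ball (0 : Space N) ρ).indicator Ψ (x - x₀)) := by
  have h1 := hΨ.le_one
  obtain ⟨⟨lam', hlam', hD⟩, hpos, -⟩ := hΨ
  obtain rfl : lam' = lam := hlam'.unique hlam
  have hc := continuous_zeroExtension hρ hD
  refine ⟨(hc.comp (continuous_id.sub continuous_const)).measurable, fun x => ?_, fun x => ?_,
    fun x hx => ?_, fun x r hr => ?_⟩
  · exact Set.indicator_nonneg (fun y hy => (hpos y hy).le) _
  · exact Set.indicator_apply_le' (fun hy => h1 _ hy) fun _ => zero_le_one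
  · refine Set.indicator_of_notMem (fun h => hx ?_) _
    rwa [mem_ball_zero_iff, ← dist_eq_norm] at h
  · rw [meanDeficit_comp_sub ((N : ℝ) / 2 + s)]
    exact meanDeficit_zeroExtension_le hρ (by linarith) (by positivity) hD hpos h1 _ hr

end Eigenfunction

end FracParabolic

theorem mainTheorem6 (N : ℕ) (hN : 1 ≤ N) (s : ℝ) (hs0 : 0 < s) (hs1 : s < 1)
    (ρ : ℝ) (hρ : 0 < ρ) (cInf : ℝ) (hcInf : 0 < cInf) :
    ∃ γ > (0 : ℝ), ∃ q > (0 : ℝ),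
      ∀ Ψ : Space N → ℝ, IsNormalizedFirstEigenfunction ρ Ψ →
      ∀ (e : Space N) (b : ℝ), ‖e‖ = 1 →
      ∀ t₀ t₁ : ℝ, t₀ < t₁ →
      ∀ x₀ ∈ halfSpace e b, 2 * ρ ≤ Metric.infDist x₀ (frontier (halfSpace e b)) →
      ∀ σ₀ σ₁ : ℝ, 0 < σ₀ → q * σ₀ ≤ σ₁ →
      ∀ c v : ℝ → Space N → ℝ,
        IsAntisymmetricSupersolution s e b (Set.Icc t₀ t₁) (Metric.ball x₀ ρ) c v →
        eLpNorm (Function.uncurry c) ∞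
          (volume.restrict (Set.Icc t₀ t₁ ×ˢ Metric.ball x₀ ρ)) ≤ ENNReal.ofReal cInf →
        (∀ t ∈ Set.Icc t₀ t₁, MemHs s (v t)) →
        (∀ t ∈ Set.Icc t₀ t₁, ∀ᵐ x ∂(volume.restrict (Metric.ball x₀ (2 * ρ))), 0 ≤ v t x) →
        (∀ t ∈ Set.Icc t₀ t₁,
          eLpNorm (fun x => max (-v t x) 0) ∞
              (volume.restrict (halfSpace e b \ Metric.ball x₀ (2 * ρ)))
            ≤ ENNReal.ofReal (σ₀ * Real.exp (-(γ + 1) * (t - t₀)))) →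
        (∀ᵐ x ∂(volume.restrict (Metric.ball x₀ ρ)), σ₁ * Ψ (x - x₀) ≤ v t₀ x) →
        ∀ t ∈ Set.Icc t₀ t₁,
          (∀ᵐ x ∂(volume.restrict (Metric.ball x₀ ρ)),
            σ₁ * Real.exp (-γ * (t - t₀)) * Ψ (x - x₀) ≤ v t x) ∧
          (ContinuousOn (v t) (Metric.ball x₀ ρ) →
            ∀ x ∈ Metric.ball x₀ ρ,
              σ₁ * Real.exp (-γ * (t - t₀)) * Ψ (x - x₀) ≤ v t x) := by
  -- the constants depend on `Ψ` only through the first eigenvalue, which is unique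
  by_cases hex : ∃ lam, IsFirstDirichletEigenvalue N ρ lam
  swap
  · exact ⟨1, one_pos, 1, one_pos, fun Ψ hΨ => absurd ⟨_, hΨ.1.choose_spec.1⟩ hex⟩
  obtain ⟨lam, hlam⟩ := hex
  have hpN : (N : ℝ) / 2 < (N : ℝ) / 2 + s := by linarith
  set A : ℝ := |lam| / (4 * (N / 2 + s)) * ∫ z : Space N, regKernel ((N : ℝ) / 2 + s) 1 z with hA
  have hA0 : 0 ≤ A := mul_nonneg (by positivity) (integral_regKernel_pos hpN one_pos).le
  obtain ⟨m, hm, hmass⟩ := exists_le_integral_of_isBump hpN A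
  obtain ⟨C, hC, q, hq, hest⟩ := exists_energy_testFun_le N hs0 hs1 hρ hA0 hm
  refine ⟨C + cInf, by positivity, q, hq, ?_⟩
  intro Ψ hΨ e b he t₀ t₁ ht x₀ hx₀ hdist σ₀ σ₁ hσ₀ hσ₁ c v hv hc hvH hv0 hvσ hinit
  set γ : ℝ := C + cInf with hγ
  set T := Set.Icc t₀ t₁ with hT
  set B := Metric.ball x₀ ρ with hB
  obtain ⟨⟨-, hUb, hcm, ⟨U', hU', hUU', hvV⟩, V, hVv, hV, hsup⟩, -, hanti⟩ := hv
  have hx₀' := le_inner_of_le_infDist he hx₀ hdist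
  set u : Space N → ℝ := fun x => (Metric.ball (0 : Space N) ρ).indicator Ψ (x - x₀) with hu
  have hbump : IsBump (N / 2 + s) A ρ x₀ u := isBump_eigenfunction hs0 hρ hlam hΨ x₀
  have huΨ : ∀ x ∈ B, u x = Ψ (x - x₀) := fun x hx => by
    refine Set.indicator_of_mem ?_ _
    rwa [mem_ball_zero_iff, ← dist_eq_norm]
  have hmu : m ≤ ∫ x, u x := by
    refine hmass ρ x₀ u hbump ?_
    obtain ⟨y, hy, hy2⟩ := hΨ.exists_half_le
    refine ⟨y + x₀, ?_⟩
    simp only [hu, add_sub_cancel_right, Set.indicator_of_mem hy]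
    exact hy2
  have hσ₁0 : 0 ≤ σ₁ := le_trans (by positivity) hσ₁
  set κ : ℝ → ℝ := fun t => σ₁ * Real.exp (-γ * (t - t₀)) with hκ
  have hκ0 : ∀ t, 0 ≤ κ t := fun t => mul_nonneg hσ₁0 (Real.exp_pos _).le
  have huH : MemHs s u := hbump.memHs hA0 hs0 hs1
  set uB : Lp ℝ 2 (volume.restrict B) := (huH.1.restrict B).toLp u with huB
  have hv0B : ∀ t ∈ T, ∀ᵐ x ∂(volume.restrict B), 0 ≤ v t x := fun t ht =>
    ae_restrict_of_ae_restrict_of_subset (Metric.ball_subset_ball (by linarith)) (hv0 t ht)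
  set f : ℝ → Lp ℝ 2 (volume.restrict B) := fun t => κ t • uB - V t with hf
  have hfx : ∀ t ∈ T, ∀ᵐ x ∂(volume.restrict B), f t x = κ t * u x - v t x := by
    intro t htT
    filter_upwards [hVv t htT, (huH.1.restrict B).coeFn_toLp, Lp.coeFn_sub (κ t • uB) (V t),
      Lp.coeFn_smul (κ t) uB] with x h1 h2 h3 h4
    rw [h3, Pi.sub_apply, h4, Pi.smul_apply, smul_eq_mul, h1, h2]
  have hφ : ∀ t ∈ T, MemHs s (testFun (κ t) u (v t)) := fun t htT => huH.testFun (hvH t htT) _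
  have hP : ∀ t (htT : t ∈ T), Lp.posPart (f t) =
      ((hφ t htT).1.restrict B).toLp (testFun (κ t) u (v t)) := by
    intro t htT
    refine Lp.ext ?_
    filter_upwards [hfx t htT, hv0B t htT, Lp.coeFn_posPart (f t),
      ((hφ t htT).1.restrict B).coeFn_toLp] with x h1 h2 h3 h4
    rw [h3, h4, h1, testFun_of_nonneg h2]
  -- for `γ = C + cInf` the velocity of `f` has nonpositive inner product with `f⁺`
  have hzero : ∀ t ∈ T, Lp.posPart (f t) = 0 := by
    intro t htT
    refine posPart_eq_zero_of_inner_deriv_nonpos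
      (f' := fun t => (-γ * κ t) • uB - derivWithin V T t) (t₀ := t₀) (t₁ := t₁) ?_ ?_ ?_ ?_ htT
    · have : Continuous κ := by fun_prop
      exact (this.smul continuous_const).continuousOn.sub hV.continuousOn
    · intro t ht'
      have h1 : HasDerivAt V (derivWithin V T t) t :=
        ((hV.differentiableOn (by simp)) t (Set.Ioo_subset_Icc_self ht')).hasDerivWithinAt
          |>.hasDerivAt (Icc_mem_nhds ht'.1 ht'.2)
      have h2 : HasDerivAt κ (-γ * κ t) t := by
        have h3 : HasDerivAt (fun t => -γ * (t - t₀)) (-γ * 1) t :=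
          ((hasDerivAt_id t).sub_const t₀).const_mul (-γ)
        refine (h3.exp.const_mul σ₁).congr_deriv ?_
        simp only [hκ]; ring
      exact (h2.smul_const uB).sub h1
    · intro t ht'
      have htT : t ∈ T := Set.Ioo_subset_Icc_self ht'
      have hφB : ∀ x ∉ B, testFun (κ t) u (v t) x = 0 := fun x hx =>
        testFun_of_eq_zero (hbump.eq_zero x hx)
      have h1 := energy_ge_of_isSupersolution hs0 ht hU' hUb hUU' hvV hvH hv0B hcm hcInf.le hc
        hVv hV (hφ t htT) (hbump.integrable_testFun (hκ0 t) (hvH t htT).1.1) hφB testFun_nonneg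
        (hsup _ ⟨hφ t htT, Eventually.of_forall hφB⟩ (Eventually.of_forall testFun_nonneg)) htT
      have hττ : 0 ≤ t - t₀ := by linarith [htT.1]
      have h2 := hest e b he x₀ hx₀' u hbump hmu (v t) (hvH t htT) (hanti t htT) (κ t)
        (σ₀ * Real.exp (-(γ + 1) * (t - t₀))) (by positivity) (by
          -- the extra decay of the bound on `v⁻` is not needed: the rate `γ` suffices
          have e1 : Real.exp (-(γ + 1) * (t - t₀)) ≤ Real.exp (-γ * (t - t₀)) :=
            Real.exp_le_exp.2 (by linarith)
          calc q * (σ₀ * Real.exp (-(γ + 1) * (t - t₀)))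
              = (q * σ₀) * Real.exp (-(γ + 1) * (t - t₀)) := by ring
            _ ≤ σ₁ * Real.exp (-γ * (t - t₀)) :=
              mul_le_mul hσ₁ e1 (Real.exp_pos _).le hσ₁0)
        ((ae_restrict_iff' measurableSet_ball).1 (hv0 t htT)) (by
          have hHm : MeasurableSet (halfSpace e b \ Metric.ball x₀ (2 * ρ)) :=
            (measurableSet_lt measurable_const (by fun_prop)).diff measurableSet_ball
          have h3 := hvσ t htT
          rw [eLpNorm_exponent_top] at h3
          rw [← ae_restrict_iff' hHm]
          filter_upwards [ae_le_eLpNormEssSup (f := fun x => max (-v t x) 0)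
            (μ := volume.restrict (halfSpace e b \ Metric.ball x₀ (2 * ρ)))] with x hx
          have h4 := hx.trans h3
          rw [← ofReal_norm, ENNReal.ofReal_le_ofReal_iff (by positivity),
            Real.norm_of_nonneg (le_max_right _ _)] at h4
          linarith [le_max_left (-v t x) 0])
      have h5 : ∫ x, u x * testFun (κ t) u (v t) x =
          inner ℝ uB (((hφ t htT).1.restrict B).toLp (testFun (κ t) u (v t))) := by
        rw [inner_toLp_eq_integral, ← setIntegral_eq_integral_of_forall_compl_eq_zero (s := B)
          fun x hx => by rw [hφB x hx, mul_zero]]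
        refine integral_congr_ae ?_
        filter_upwards [(huH.1.restrict B).coeFn_toLp] with x hx
        rw [huB, hx]
      rw [h5] at h2
      rw [← hP t htT] at h1 h2
      have h6 : 0 ≤ inner ℝ (f t) (Lp.posPart (f t)) := by
        rw [L2.inner_def]
        refine integral_nonneg_of_ae ?_
        filter_upwards [Lp.coeFn_posPart (f t)] with x hx
        rw [hx]
        simp only [RCLike.inner_apply, conj_trivial, Pi.zero_apply]
        rcases le_total (f t x) 0 with h | h
        · simp [max_eq_right h]
        · rw [max_eq_left h]; exact mul_self_nonneg _
      have h7 : inner ℝ (f t) (Lp.posPart (f t)) =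
          κ t * inner ℝ uB (Lp.posPart (f t)) - inner ℝ (V t) (Lp.posPart (f t)) := by
        conv_lhs => rw [hf]
        simp only [inner_sub_left, real_inner_smul_left]
        rfl
      rw [real_inner_comm, inner_sub_left, real_inner_smul_left]
      have h8 : inner ℝ (V t) (Lp.posPart (f t)) ≤ κ t * inner ℝ uB (Lp.posPart (f t)) := by
        linarith
      have h9 := mul_le_mul_of_nonneg_left h8 hcInf.le
      rw [hγ]
      linarith
    · have h0T : t₀ ∈ T := Set.left_mem_Icc.2 ht.le
      refine Lp.ext ?_
      filter_upwards [hfx t₀ h0T, hinit, Lp.coeFn_posPart (f t₀), Lp.coeFn_zero ℝ 2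
        (volume.restrict B), ae_restrict_mem measurableSet_ball] with x h1 h2 h3 h4 h5
      rw [h3, h4, h1, huΨ x h5]
      simp only [hκ, sub_self, mul_zero, Real.exp_zero, mul_one, Pi.zero_apply]
      exact max_eq_right (by linarith)
  intro t htT
  have hae : ∀ᵐ x ∂(volume.restrict B), κ t * Ψ (x - x₀) ≤ v t x := by
    have h1 : Lp.posPart (f t) =ᵐ[volume.restrict B] 0 := by
      rw [hzero t htT]; exact Lp.coeFn_zero ℝ 2 _
    filter_upwards [hfx t htT, h1, Lp.coeFn_posPart (f t), ae_restrict_mem measurableSet_ball]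
      with x h1 h2 h3 h4
    rw [h3, h1, Pi.zero_apply, huΨ x h4] at h2
    linarith [max_eq_right_iff.1 h2]
  refine ⟨hae, fun hcont => ?_⟩
  refine le_of_ae_le_of_continuousOn Metric.isOpen_ball ?_ hcont hae
  obtain ⟨⟨lam', -, hD⟩, -, -⟩ := hΨ
  refine continuousOn_const.mul (hD.1.continuousOn.comp (by fun_prop) fun x hx => ?_)
  rwa [mem_ball_zero_iff, ← dist_eq_norm]
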